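/- Let $p$ be an odd prime, $m\ge 1$ an integer, $q=p^m$, and let $\mathrm{Tr}$ denote the trace from $\mathrm{GF}(q)$ to $\mathrm{GF}(p)$. Let $$\mathcal C=\left\{\left(\mathrm{Tr}(ax^2+bx+c)\right)_{x\in \mathrm{GF}(q)} : a,b,c\in \mathrm{GF}(q)\right\},$$ a linear code over $\mathrm{GF}(p)$ whose coordinate positions are the elements of $\mathrm{GF}(q)$. Let $T=\mathrm{GF}(p)\subseteq \mathrm{GF}(q)$, and let $\mathcal C_T$ be the shortened code of $\mathcal C$ on $T$, that is, the code obtained by taking all codewords of $\mathcal C$ that are zero on $T$ and deleting their coordinates in $T$. Then $\mathcal C_T$ is a $[p^m-p,\,2m-2]$ linear code over $\mathrm{GF}(p)$ (length $p^m-p$, dimension $2m-2$), and its weight distribution is as follows. In each case the listed weights are pairwise distinct, the multiplicity of a weight is the number of codewords of that Hamming weight (it may be $0$ for small $m$), and no codeword has a weight that is not listed. (1) If $m$ is odd, put $B=(-1)^{\frac{q-1}{2}+\frac{(p-1)(m-1)}{4}}\,p^{(m-1)/2}$. The weights and multiplicities are: $$\begin{array}{ll} \text{Weight} & \text{Multiplicity}\\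 0 & 1\\ p^{m-1}(p-1) & (p^{m-1}-1)(p^{m-2}+1)\\ p^{m-1}(p-1)-p^{\frac{m-1}{2}}(-1)^{\frac{(p-1)(m+1)}{4}} & \frac{p^{m-1}-1}{2}\,(p-1)(p^{m-2}+B)\\ p^{m-1}(p-1)+p^{\frac{m-1}{2}}(-1)^{\frac{(p-1)(m+1)}{4}} & \frac{p^{m-1}-1}{2}\,(p-1)(p^{m-2}-B) \end{array}$$ (2) If $m$ is even, put $B_1=\frac12\left(p^{m-1}-1-(p-1)p^{\frac{m-2}{2}}(\sqrt{-1})^{\frac{(p-1)m}{2}}\right)$ and $B_2=(-1)^{\frac{q+1}{2}+\frac{m(p-1)}{4}}(p-1)p^{(m-2)/2}$. The weights and multiplicities are: $$\begin{array}{ll} \text{Weight} & \text{Multiplicity}\\ 0 & 1\\ p^{m-1}(p-1) & p^{m-1}-1\\ p^{m-1}(p-1)-(p-1)p^{\frac{m-2}{2}}(-1)^{\frac{m(p-1)+4}{4}} & B_1\,(p^{m-2}+B_2)\\ p^{m-1}(p-1)-(p-1)p^{\frac{m-2}{2}}(-1)^{\frac{m(p-1)}{4}} & (p^{m-1}-1-B_1)(p^{m-2}-B_2)\\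 p^{m-1}(p-1)-p^{\frac{m-2}{2}}(-1)^{\frac{m(p-1)}{4}} & B_1\,(p^{m-1}-p^{m-2}-B_2)\\ p^{m-1}(p-1)-p^{\frac{m-2}{2}}(-1)^{\frac{m(p-1)+4}{4}} & (p^{m-1}-1-B_1)(p^{m-1}-p^{m-2}+B_2) \end{array}$$ -/

import Mathlib

open Polynomial

/-- The code `{(Tr(a f(x) + b x + c))_{x ∈ F} : a, b, c ∈ F}` over `GF(p) = ZMod p`, where `Tr` is
the trace from `F` to `GF(p)`. The coordinate positions are the elements of `F`. -/
noncomputable def traceCode (p : ℕ) [Fact p.Prime] (F : Type*) [Field F] [Algebra (ZMod p) F]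
    (f : F[X]) : Submodule (ZMod p) (F → ZMod p) where
  carrier := {v | ∃ a b c : F, v = fun x => Algebra.trace (ZMod p) F (a * f.eval x + b * x + c)}
  zero_mem' := ⟨0, 0, 0, by funext x; simp⟩
  add_mem' := by
    rintro _ _ ⟨a, b, c, rfl⟩ ⟨a', b', c', rfl⟩
    refine ⟨a + a', b + b', c + c', ?_⟩
    funext x
    rw [Pi.add_apply, ← map_add]
    congr 1
    ring
  smul_mem' := by
    rintro r _ ⟨a, b, c, rfl⟩
    refine ⟨r • a, r • b, r • c, ?_⟩
    funext x
    rw [Pi.smul_apply, ← map_smul]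
    simp only [smul_add, smul_mul_assoc]

/-- `C(T)`: the codewords of `C` that vanish on the set `T` of coordinate positions. -/
def subcodeVanishingOn {ι K : Type*} [Field K] (C : Submodule K (ι → K)) (T : Set ι) :
    Submodule K (ι → K) where
  carrier := {v | v ∈ C ∧ ∀ i ∈ T, v i = 0}
  zero_mem' := ⟨C.zero_mem, fun _ _ => rfl⟩
  add_mem' := fun {u v} hu hv =>
    ⟨C.add_mem hu.1 hv.1, fun i hi => by rw [Pi.add_apply, hu.2 i hi, hv.2 i hi, add_zero]⟩
  smul_mem' := fun r v hv =>
    ⟨C.smul_mem r hv.1, fun i hi => by rw [Pi.smul_apply, hv.2 i hi, smul_zero]⟩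

/-- Puncturing `C` on `T`: delete the coordinates in `T` from every codeword. -/
def puncturedCode {ι K : Type*} [Field K] (C : Submodule K (ι → K)) (T : Set ι) :
    Submodule K ({i : ι // i ∉ T} → K) :=
  C.map (LinearMap.funLeft K K (Subtype.val : {i : ι // i ∉ T} → ι))

/-- The shortened code `C_T`: the subcode `C(T)` punctured on `T`. -/
def shortenedCode {ι K : Type*} [Field K] (C : Submodule K (ι → K)) (T : Set ι) :
    Submodule K ({i : ι // i ∉ T} → K) :=
  puncturedCode (subcodeVanishingOn C T) T

/-- `C` is an `[n, k]` linear code: it has length `n` and dimension `k`. -/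
def IsLinearCode {ι K : Type*} [Field K] (C : Submodule K (ι → K)) (n k : ℕ) : Prop :=
  Nat.card ι = n ∧ Module.finrank K C = k

open Classical in
/-- `A_w`: the number of codewords of `C` of Hamming weight `w`. -/
noncomputable def numCodewords {ι K : Type*} [Finite ι] [Field K] (C : Submodule K (ι → K))
    (w : ℕ) : ℕ :=
  haveI := Fintype.ofFinite ι
  Set.ncard {v : ι → K | v ∈ C ∧ hammingNorm v = w}

/-- The weight distribution of `C` is given by a table with rows `(weight, multiplicity)`: the
weights of the rows are distinct natural numbers, each row lists the number of codewords of its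
weight, and no codeword has a weight that is not listed. -/
def HasWeightTable {ι K : Type*} [Finite ι] [Field K] (C : Submodule K (ι → K))
    (table : List (ℤ × ℂ)) : Prop :=
  (table.map Prod.fst).Nodup ∧
  (∀ row ∈ table, ∃ w : ℕ, (w : ℤ) = row.1 ∧ (numCodewords C w : ℂ) = row.2) ∧
  ∀ w : ℕ, numCodewords C w ≠ 0 → (w : ℤ) ∈ table.map Prod.fst

/-- `B = (-1)^{(q-1)/2 + (p-1)(m-1)/4} p^{(m-1)/2}` with `q = p^m`; for `p` and `m` odd all
the divisions are exact. -/
noncomputable def constB (p m : ℕ) : ℂ :=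
  (-1) ^ ((p ^ m - 1) / 2 + (p - 1) * (m - 1) / 4) * (p : ℂ) ^ ((m - 1) / 2)

/-- `B₁ = (p^{m-1} - 1 - (p-1) p^{(m-2)/2} (√-1)^{(p-1)m/2}) / 2`, for `p` odd and `m` even. -/
noncomputable def constB₁ (p m : ℕ) : ℂ :=
  ((p : ℂ) ^ (m - 1) - 1
    - ((p : ℂ) - 1) * (p : ℂ) ^ ((m - 2) / 2) * Complex.I ^ ((p - 1) * m / 2)) / 2

/-- `B₂ = (-1)^{(q+1)/2 + m(p-1)/4} (p-1) p^{(m-2)/2}` with `q = p^m`; for `p` odd and `m` even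
all the divisions are exact. -/
noncomputable def constB₂ (p m : ℕ) : ℂ :=
  (-1) ^ ((p ^ m + 1) / 2 + m * (p - 1) / 4) * ((p : ℂ) - 1) * (p : ℂ) ^ ((m - 2) / 2)

/-- The rows `(weight, multiplicity)` for `m` odd. The power `p^{m-2}` has an integer exponent,
which is `-1` for `m = 1`. -/
noncomputable def oddTable (p m : ℕ) : List (ℤ × ℂ) :=
  [ (0, 1),
    ((p : ℤ) ^ (m - 1) * ((p : ℤ) - 1),
      ((p : ℂ) ^ (m - 1) - 1) * ((p : ℂ) ^ ((m : ℤ) - 2) + 1)),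
    ((p : ℤ) ^ (m - 1) * ((p : ℤ) - 1) - (p : ℤ) ^ ((m - 1) / 2) * (-1) ^ ((p - 1) * (m + 1) / 4),
      ((p : ℂ) ^ (m - 1) - 1) / 2 * (((p : ℂ) - 1) * ((p : ℂ) ^ ((m : ℤ) - 2) + constB p m))),
    ((p : ℤ) ^ (m - 1) * ((p : ℤ) - 1) + (p : ℤ) ^ ((m - 1) / 2) * (-1) ^ ((p - 1) * (m + 1) / 4),
      ((p : ℂ) ^ (m - 1) - 1) / 2 * (((p : ℂ) - 1) * ((p : ℂ) ^ ((m : ℤ) - 2) - constB p m))) ]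

/-- The rows `(weight, multiplicity)` for `m ≥ 2` even. -/
noncomputable def evenTable (p m : ℕ) : List (ℤ × ℂ) :=
  [ (0, 1),
    ((p : ℤ) ^ (m - 1) * ((p : ℤ) - 1), (p : ℂ) ^ (m - 1) - 1),
    ((p : ℤ) ^ (m - 1) * ((p : ℤ) - 1)
        - ((p : ℤ) - 1) * (p : ℤ) ^ ((m - 2) / 2) * (-1) ^ ((m * (p - 1) + 4) / 4),
      constB₁ p m * ((p : ℂ) ^ (m - 2) + constB₂ p m)),
    ((p : ℤ) ^ (m - 1) * ((p : ℤ) - 1)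
        - ((p : ℤ) - 1) * (p : ℤ) ^ ((m - 2) / 2) * (-1) ^ (m * (p - 1) / 4),
      ((p : ℂ) ^ (m - 1) - 1 - constB₁ p m) * ((p : ℂ) ^ (m - 2) - constB₂ p m)),
    ((p : ℤ) ^ (m - 1) * ((p : ℤ) - 1) - (p : ℤ) ^ ((m - 2) / 2) * (-1) ^ (m * (p - 1) / 4),
      constB₁ p m * ((p : ℂ) ^ (m - 1) - (p : ℂ) ^ (m - 2) - constB₂ p m)),
    ((p : ℤ) ^ (m - 1) * ((p : ℤ) - 1) - (p : ℤ) ^ ((m - 2) / 2) * (-1) ^ ((m * (p - 1) + 4) / 4),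
      ((p : ℂ) ^ (m - 1) - 1 - constB₁ p m)
        * ((p : ℂ) ^ (m - 1) - (p : ℂ) ^ (m - 2) + constB₂ p m)) ]

/-! On `t` in GF(p) a word takes the value `t² Tr a + t Tr b + Tr c`. Its vanishing at `0, 1, -1`
forces all three traces to be zero, so C(T) is the injective image of H × H, where H is the
trace-zero hyperplane (`subcodeVanishingOn_traceCode_eq`).

For `a ≠ 0`, completing the square shows that the word of `(a, b)` has N_a(c) zeros, where c =
Tr(b²/4a) and N_a(c) = #{x : Tr(a x²) = c}. No Gauss sums are needed: with D_a = N_a - p^(m-1), the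
first two moments of N_a, its invariance under c ↦ c t² and its parity give D_a(0) = -(p-1)e and
D_a(c) = e + f χ(c) for c ≠ 0, where χ is the quadratic character and e, f are integers with p e² +
f² = p^(m-1) (`exists_traceSqDev_eq`). Descent then leaves e = 0 for odd m and f = 0 for even m.

For `a` in H the shift b ↦ b + 2ta fixes Tr b and adds t Tr b to Tr(b²/4a). Off H this value is
therefore equidistributed, and on H it equals c exactly p^(m-2) + D_a(c) times. So the pairs with
deviation d number p^(m-2) + d times the sum over `a` of #{c : D_a(c) = d}
(`numCodewords_eq_sum_card_traceSqDev`).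

For odd m the unknown sign of D_a is immaterial, since χ takes both signs equally often. For even m
the signs are counted by a double count of Σ_a D_a(0), which uses that GF(p) consists of squares of
GF(q) (`sum_traceSqDev_zero_of_even`). -/

open Finset in
/-- All fibres of a nonzero linear functional on a finite vector space have the same size. -/
lemma card_fiber_mul_of_ne_zero {K V : Type*} [Field K] [Fintype K] [DecidableEq K]
    [AddCommGroup V] [Fintype V] [Module K V] {f : V →ₗ[K] K} (hf : f ≠ 0) (c : K) :
    #{x : V | f x = c} * Fintype.card K = Fintype.card V := by
  have hs : Function.Surjective f := LinearMap.surjective hf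
  have h : ∀ d : K, #{x : V | f x = d} = #{x : V | f x = c} := fun d =>
    AddMonoidHom.card_fiber_eq_of_mem_range f.toAddMonoidHom (hs d) (hs c)
  have h2 := card_eq_sum_card_fiberwise (s := (univ : Finset V)) (t := (univ : Finset K))
    (f := f) (fun _ _ => by simp)
  rw [card_univ] at h2
  rw [h2, sum_congr rfl fun d _ => h d, sum_const, card_univ, smul_eq_mul, mul_comm]

/-! ### Value counts of Tr(a x²): moments and symmetries -/

section counts

open Finset

variable {p : ℕ} [Fact p.Prime] {F : Type*} [Field F] [Algebra (ZMod p) F]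

/-- The linear functional `x ↦ Tr(a x)`. -/
noncomputable def traceMul (p : ℕ) [Fact p.Prime] {F : Type*} [Field F] [Algebra (ZMod p) F]
    (a : F) : F →ₗ[ZMod p] ZMod p :=
  (Algebra.trace (ZMod p) F) ∘ₗ (LinearMap.mulLeft (ZMod p) a)

@[simp] lemma traceMul_apply (a x : F) : traceMul p a x = Algebra.trace (ZMod p) F (a * x) := rfl

lemma trace_algebraMap_mul (t : ZMod p) (x : F) :
    Algebra.trace (ZMod p) F (algebraMap (ZMod p) F t * x) = t * Algebra.trace (ZMod p) F x := by
  rw [← Algebra.smul_def, map_smul, smul_eq_mul]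

lemma eq_zero_of_forall_trace_mul [Finite F] {a : F}
    (h : ∀ x, Algebra.trace (ZMod p) F (a * x) = 0) : a = 0 :=
  (traceForm_nondegenerate (ZMod p) F).1 a fun x => by simpa using h x

lemma traceMul_ne_zero [Finite F] {a : F} (ha : a ≠ 0) : traceMul p a ≠ 0 := fun h =>
  ha (eq_zero_of_forall_trace_mul (p := p) fun x => by simpa using LinearMap.congr_fun h x)

lemma two_ne_zero_of_algebra_zmod (hp : p ≠ 2) : (2 : F) ≠ 0 := by
  have : CharP F p := (Algebra.charP_iff (ZMod p) F p).mp inferInstance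
  exact Ring.two_ne_zero (by rwa [ringChar.eq F p])

variable [Fintype F]

/-- The number of `x` with `Tr(a x²) = c`. -/
noncomputable def traceSqCount (a : F) (c : ZMod p) : ℕ :=
  #{x : F | Algebra.trace (ZMod p) F (a * x ^ 2) = c}

variable {m : ℕ}

lemma card_trace_mul_eq (hF : Fintype.card F = p ^ m) (hm : 1 ≤ m) {a : F} (ha : a ≠ 0)
    (c : ZMod p) : #{x : F | Algebra.trace (ZMod p) F (a * x) = c} = p ^ (m - 1) := by
  have h := card_fiber_mul_of_ne_zero (traceMul_ne_zero (p := p) ha) c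
  rw [hF, ZMod.card] at h
  obtain ⟨k, rfl⟩ := Nat.exists_eq_add_of_le' hm
  rw [pow_succ] at h
  exact Nat.eq_of_mul_eq_mul_right (Fact.out : p.Prime).pos h

lemma sum_traceSqCount (hF : Fintype.card F = p ^ m) (a : F) :
    ∑ c : ZMod p, traceSqCount a c = p ^ m := by
  rw [← hF, ← card_univ]
  exact (card_eq_sum_card_fiberwise (s := (univ : Finset F)) (t := (univ : Finset (ZMod p)))
    (f := fun x => Algebra.trace (ZMod p) F (a * x ^ 2)) (fun _ _ => by simp)).symm

/-- The sum counts pairs with Tr(a x²) = Tr(a y²). As 2 is invertible, u = x - y and v = x + y are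
new coordinates, and the condition becomes Tr(a u v) = 0, which is linear in v for each u. -/
lemma sum_traceSqCount_sq (hp : p ≠ 2) (hF : Fintype.card F = p ^ m) (hm : 1 ≤ m) {a : F}
    (ha : a ≠ 0) :
    ∑ c : ZMod p, traceSqCount a c ^ 2 = p ^ m + (p ^ m - 1) * p ^ (m - 1) := by
  classical
  have h2 := two_ne_zero_of_algebra_zmod (F := F) hp
  have h1 : ∑ c : ZMod p, traceSqCount a c ^ 2 =
      #{z : F × F | Algebra.trace (ZMod p) F (a * z.1 ^ 2)
        = Algebra.trace (ZMod p) F (a * z.2 ^ 2)} := by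
    rw [card_eq_sum_card_fiberwise (t := (univ : Finset (ZMod p)))
      (f := fun z : F × F => Algebra.trace (ZMod p) F (a * z.1 ^ 2)) (fun _ _ => by simp)]
    refine sum_congr rfl fun c _ => ?_
    rw [traceSqCount, sq, ← card_product]
    congr 1
    ext z
    simp only [mem_product, mem_filter, mem_univ, true_and]
    constructor
    · rintro ⟨h, h'⟩
      exact ⟨h.trans h'.symm, h⟩
    · rintro ⟨h, h'⟩
      exact ⟨h', h.symm.trans h'⟩
  have h3 : #{z : F × F | Algebra.trace (ZMod p) F (a * z.1 ^ 2)
        = Algebra.trace (ZMod p) F (a * z.2 ^ 2)} =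
      #{z : F × F | Algebra.trace (ZMod p) F (a * z.1 * z.2) = 0} := by
    refine card_nbij' (fun z => (z.1 - z.2, z.1 + z.2))
      (fun w => ((w.1 + w.2) / 2, (w.2 - w.1) / 2)) ?_ ?_ ?_ ?_
    · intro z hz
      simp only [coe_filter, mem_univ, true_and, Set.mem_ofPred_eq] at hz ⊢
      rw [← sub_eq_zero, ← map_sub] at hz
      rw [← hz]
      congr 1
      ring
    · intro z hz
      simp only [coe_filter, mem_univ, true_and, Set.mem_ofPred_eq] at hz ⊢
      rw [← sub_eq_zero, ← map_sub, ← hz]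
      congr 1
      field_simp
      ring
    · intro z _
      ext <;> simp <;> field_simp <;> ring
    · intro z _
      ext <;> simp <;> field_simp <;> ring
  rw [h1, h3, card_eq_sum_card_fiberwise (t := (univ : Finset F)) (f := fun z : F × F => z.1)
    (fun _ _ => by simp)]
  have h4 : ∀ u : F, #{z ∈ ({z : F × F | Algebra.trace (ZMod p) F (a * z.1 * z.2) = 0} :
      Finset (F × F)) | z.1 = u} = #{v : F | Algebra.trace (ZMod p) F (a * u * v) = 0} := by
    intro u
    refine card_nbij' (fun z => z.2) (fun v => (u, v)) ?_ ?_ ?_ ?_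
    · rintro ⟨z, w⟩ hz
      simp at hz ⊢
      rw [← hz.2]; exact hz.1
    · intro v hv
      simpa using hv
    · rintro ⟨z, w⟩ hz
      simp at hz ⊢
      exact hz.2.symm
    · intro v _
      rfl
  -- For u = 0 every v counts; each other u gives a hyperplane of v's.
  rw [sum_congr rfl fun u _ => h4 u, ← add_sum_erase _ _ (mem_univ (0 : F))]
  congr 1
  · simp [hF]
  · rw [sum_congr rfl fun u hu => card_trace_mul_eq hF hm (mul_ne_zero ha (ne_of_mem_erase hu)) 0]
    simp [hF]

/-- Replacing x by t x pulls t² out of the trace. Hence for nonzero c only the square class matters.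
-/
lemma traceSqCount_mul_sq (a : F) (c : ZMod p) {t : ZMod p} (ht : t ≠ 0) :
    traceSqCount a (c * t ^ 2) = traceSqCount a c := by
  have ht' : algebraMap (ZMod p) F t ≠ 0 := by simpa using ht
  refine card_nbij' (fun x => x / algebraMap (ZMod p) F t) (fun x => x * algebraMap (ZMod p) F t)
    ?_ ?_ ?_ ?_
  · intro x hx
    simp only [coe_filter, mem_univ, true_and, Set.mem_ofPred_eq] at hx ⊢
    have h : a * x ^ 2 = algebraMap (ZMod p) F (t ^ 2) * (a * (x / algebraMap (ZMod p) F t) ^ 2) := by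
      rw [map_pow]
      field_simp
    rw [h, trace_algebraMap_mul, mul_comm] at hx
    exact mul_right_cancel₀ (pow_ne_zero 2 ht) hx
  · intro x hx
    simp only [coe_filter, mem_univ, true_and, Set.mem_ofPred_eq] at hx ⊢
    have h : a * (x * algebraMap (ZMod p) F t) ^ 2 = algebraMap (ZMod p) F (t ^ 2) * (a * x ^ 2) := by
      rw [map_pow]
      ring
    rw [h, trace_algebraMap_mul, hx, mul_comm]
  · intro x _
    field_simp
  · intro x _
    field_simp

/-- The involution x ↦ -x fixes only 0, which lies over c = 0. This parity is what makes e and f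
integers in `exists_traceSqDev_eq`. -/
lemma even_traceSqCount (hp : p ≠ 2) (a : F) {c : ZMod p} (hc : c ≠ 0) :
    Even (traceSqCount a c) := by
  have h2 := two_ne_zero_of_algebra_zmod (F := F) hp
  rw [even_iff_two_dvd, ← ZMod.natCast_eq_zero_iff, traceSqCount, card_eq_sum_ones, Nat.cast_sum]
  refine sum_involution (fun x _ => -x) (fun _ _ => by decide) ?_ ?_ ?_
  · intro x hx _ h
    have hx0 : x = 0 := by
      have : 2 * x = 0 := by linear_combination -h
      simpa [h2] using this
    simp [hx0] at hx
    exact hc hx.symm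
  · intro x hx
    simpa using hx
  · intro x _
    simp

end counts

/-- Solutions of `p e² + f² = p ^ k` in integers: one of `e`, `f` vanishes. -/
lemma prime_mul_sq_add_sq_eq_pow {p : ℕ} (hp : p.Prime) (k : ℕ) :
    ∀ e f : ℤ, p * e ^ 2 + f ^ 2 = (p : ℤ) ^ k →
      (Even k → e = 0 ∧ f ^ 2 = (p : ℤ) ^ k) ∧ (Odd k → f = 0 ∧ e ^ 2 = (p : ℤ) ^ (k - 1)) := by
  have hp2 : (2 : ℤ) ≤ p := by exact_mod_cast hp.two_le
  have hp0 : (p : ℤ) ≠ 0 := by positivity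
  induction k with
  | zero =>
    intro e f h
    rw [pow_zero] at h
    have he : e = 0 := by
      by_contra he
      have : 0 < e ^ 2 := by positivity
      nlinarith [sq_nonneg f]
    subst he
    refine ⟨fun _ => ⟨rfl, by simpa using h⟩, fun h => by simp at h⟩
  | succ k ih =>
    intro e f h
    have hd : (p : ℤ) ∣ f := by
      refine (Nat.prime_iff_prime_int.mp hp).dvd_of_dvd_pow (n := 2) ⟨(p : ℤ) ^ k - e ^ 2, ?_⟩
      rw [pow_succ] at h
      linear_combination h
    obtain ⟨g, rfl⟩ := hd
    -- With f = p g, cancelling p returns the same equation with the two roles exchanged and the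
    -- exponent lowered by one.
    have h1 : p * g ^ 2 + e ^ 2 = (p : ℤ) ^ k := by
      apply mul_left_cancel₀ hp0
      rw [pow_succ] at h
      linear_combination h
    obtain ⟨h2, h3⟩ := ih g e h1
    constructor
    · intro hk
      have hk' : Odd k := by
        rw [← Nat.not_even_iff_odd]
        exact Nat.even_add_one.mp hk
      obtain ⟨he, hg⟩ := h3 hk'
      obtain ⟨j, rfl⟩ := hk'
      refine ⟨he, ?_⟩
      rw [mul_pow, hg]
      simp only [Nat.add_sub_cancel]
      ring
    · intro hk
      have hk' : Even k := by
        rw [← Nat.not_odd_iff_even]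
        exact Nat.odd_add_one.mp hk
      obtain ⟨hg, he⟩ := h2 hk'
      exact ⟨by rw [hg, mul_zero], by simpa using he⟩

/-! ### Deviations of the counts from their mean -/

section deviation

open Finset

variable {p : ℕ} [Fact p.Prime] {F : Type*} [Field F] [Algebra (ZMod p) F] [Fintype F] {m : ℕ}

/-- The deviation of the number of `x` with `Tr(a x²) = c` from `p ^ (m - 1)`. -/
noncomputable def traceSqDev (m : ℕ) (a : F) (c : ZMod p) : ℤ :=
  traceSqCount a c - (p : ℤ) ^ (m - 1)

lemma sum_traceSqDev (hF : Fintype.card F = p ^ m) (hm : 1 ≤ m) (a : F) :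
    ∑ c : ZMod p, traceSqDev m a c = 0 := by
  have h := sum_traceSqCount hF a
  obtain ⟨k, rfl⟩ := Nat.exists_eq_add_of_le' hm
  zify at h
  simp only [traceSqDev, sum_sub_distrib, h, sum_const, card_univ, ZMod.card, nsmul_eq_mul,
    Nat.add_sub_cancel]
  ring

lemma sum_traceSqDev_sq (hp : p ≠ 2) (hF : Fintype.card F = p ^ m) (hm : 1 ≤ m) {a : F}
    (ha : a ≠ 0) : ∑ c : ZMod p, traceSqDev m a c ^ 2 = (p - 1) * (p : ℤ) ^ (m - 1) := by
  have h := sum_traceSqCount hF a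
  have h2 := sum_traceSqCount_sq hp hF hm ha
  obtain ⟨k, rfl⟩ := Nat.exists_eq_add_of_le' hm
  have h3 : 1 ≤ p ^ (k + 1) := Nat.one_le_pow _ _ (Fact.out : p.Prime).pos
  zify [h3] at h h2
  simp only [traceSqDev, sub_sq, sum_sub_distrib, sum_add_distrib, h2, sum_const, card_univ,
    ZMod.card, nsmul_eq_mul, Nat.add_sub_cancel, ← sum_mul, ← mul_sum, h]
  ring

/-- Off 0 the deviation depends only on the square class, so it is determined by two values, with
half-sum e and half-difference f. The zero sum gives the value at 0, and the second moment gives the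
quadratic equation. -/
lemma exists_traceSqDev_eq (hp : p ≠ 2) (hF : Fintype.card F = p ^ m) (hm : 1 ≤ m) {a : F}
    (ha : a ≠ 0) :
    ∃ e f : ℤ, p * e ^ 2 + f ^ 2 = (p : ℤ) ^ (m - 1) ∧
      traceSqDev m a (0 : ZMod p) = -((p - 1) * e) ∧
      ∀ c : ZMod p, c ≠ 0 → traceSqDev m a c = e + f * quadraticChar (ZMod p) c := by
  have hp1 : p.Prime := Fact.out
  have hchar : ringChar (ZMod p) ≠ 2 := by rwa [ZMod.ringChar_zmod_n]
  obtain ⟨n, hn⟩ := FiniteField.exists_nonsquare hchar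
  have hn0 : n ≠ 0 := by
    rintro rfl
    exact hn (IsSquare.zero)
  have hodd : Odd ((p : ℤ) ^ (m - 1)) := by
    exact_mod_cast (hp1.odd_of_ne_two hp).pow
  have hpar : ∀ c : ZMod p, c ≠ 0 → Odd (traceSqDev m a c) := fun c hc => by
    have : Even (traceSqCount a c : ℤ) := by exact_mod_cast even_traceSqCount hp a hc
    exact this.sub_odd hodd
  -- Both deviations are odd, being an even count minus a power of the odd p, so their sum and
  -- difference can be halved.
  obtain ⟨e, he⟩ := (hpar (1 : ZMod p) one_ne_zero).add_odd (hpar n hn0)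
  obtain ⟨f, hf⟩ := (hpar 1 one_ne_zero).sub_odd (hpar n hn0)
  have hval : ∀ c : ZMod p, c ≠ 0 → traceSqDev m a c = e + f * quadraticChar (ZMod p) c := by
    intro c hc
    rcases quadraticChar_dichotomy hc with h | h
    · rw [h]
      obtain ⟨t, rfl⟩ := (quadraticChar_one_iff_isSquare hc).mp h
      have ht : t ≠ 0 := by
        rintro rfl
        simp at hc
      have h3 : traceSqDev m a (t * t) = traceSqDev m a (1 : ZMod p) := by
        rw [traceSqDev, traceSqDev, ← traceSqCount_mul_sq a (1 : ZMod p) ht]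
        ring_nf
      linarith
    · rw [h]
      have h1 : quadraticChar (ZMod p) (c * n) = 1 := by
        rw [map_mul, h, quadraticChar_neg_one_iff_not_isSquare.mpr hn]
        norm_num
      obtain ⟨t, ht2⟩ := (quadraticChar_one_iff_isSquare (mul_ne_zero hc hn0)).mp h1
      have ht : t ≠ 0 := by
        rintro rfl
        simp [hc, hn0] at ht2
      have h3 : traceSqDev m a c = traceSqDev m a n := by
        have : c = n * (t / n) ^ 2 := by
          field_simp
          rw [sq, ← ht2]
        rw [traceSqDev, traceSqDev, this, traceSqCount_mul_sq a n (div_ne_zero ht hn0)]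
      linarith
  have hsum := quadraticChar_sum_zero hchar
  rw [← add_sum_erase _ _ (mem_univ (0 : ZMod p)), MulChar.map_zero, zero_add] at hsum
  have hcard : ((#(univ.erase (0 : ZMod p)) : ℕ) : ℤ) = p - 1 := by
    rw [card_erase_of_mem (mem_univ _), card_univ, ZMod.card, Nat.cast_pred hp1.pos]
  have h0 := sum_traceSqDev hF hm a
  have h2 := sum_traceSqDev_sq hp hF hm ha
  rw [← add_sum_erase _ _ (mem_univ (0 : ZMod p)),
    sum_congr rfl fun c hc => hval c (ne_of_mem_erase hc)] at h0
  rw [← add_sum_erase _ _ (mem_univ (0 : ZMod p)),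
    sum_congr rfl fun c hc => show traceSqDev m a c ^ 2 =
      (e ^ 2 + f ^ 2) + 2 * e * f * quadraticChar (ZMod p) c by
        rw [hval c (ne_of_mem_erase hc)]
        linear_combination f ^ 2 * quadraticChar_sq_one (ne_of_mem_erase hc)] at h2
  rw [sum_add_distrib, ← mul_sum, hsum, sum_const, nsmul_eq_mul, hcard] at h0 h2
  have h00 : traceSqDev m a (0 : ZMod p) = -((p - 1) * e) := by linear_combination h0
  refine ⟨e, f, ?_, h00, hval⟩
  have hp0 : ((p : ℤ) - 1) ≠ 0 := by
    have : (2 : ℤ) ≤ p := by exact_mod_cast hp1.two_le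
    lia
  apply mul_left_cancel₀ hp0
  rw [h00] at h2
  linear_combination h2

/-- For odd `m`, the deviation vanishes at `0`, and it takes each of the values
`± p ^ ((m - 1) / 2)` equally often. -/
lemma card_traceSqDev_eq_of_odd (hp : p ≠ 2) (hF : Fintype.card F = p ^ m) (hm : Odd m) {a : F}
    (ha : a ≠ 0) (d : ℤ) :
    (2 * #{c : ZMod p | traceSqDev m a c = d} : ℤ) =
      if d = 0 then 2 else if d ^ 2 = (p : ℤ) ^ (m - 1) then (p : ℤ) - 1 else 0 := by
  have hp1 : p.Prime := Fact.out
  have hchar : ringChar (ZMod p) ≠ 2 := by rwa [ZMod.ringChar_zmod_n]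
  obtain ⟨e, f, hef, h0, hc⟩ := exists_traceSqDev_eq hp hF hm.pos ha
  obtain ⟨he, hf⟩ := (prime_mul_sq_add_sq_eq_pow hp1 _ e f hef).1 (Nat.Odd.sub_odd hm odd_one)
  have hf0 : f ≠ 0 := by
    rintro rfl
    exact pow_ne_zero (m - 1) (Nat.cast_ne_zero.mpr hp1.ne_zero : (p : ℤ) ≠ 0)
      (by rw [← hf]; simp)
  have hval : ∀ c : ZMod p, traceSqDev m a c = f * quadraticChar (ZMod p) c := fun c => by
    by_cases h : c = 0
    · rw [h, h0, he, MulChar.map_zero, mul_zero, mul_zero, neg_zero]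
    · rw [hc c h, he, zero_add]
  simp only [hval, ← hf]
  split_ifs with hd hd2
  · subst hd
    have h1 : ∀ c : ZMod p, f * quadraticChar (ZMod p) c = 0 ↔ c = 0 := fun c => by
      rw [mul_eq_zero, or_iff_right hf0, quadraticChar_eq_zero_iff]
    rw [card_eq_one.mpr ⟨0, by ext c; simp only [mem_filter, mem_univ, true_and, mem_singleton, h1]⟩]
    norm_num
  · obtain ⟨s, hs, rfl⟩ : ∃ s : ℤ, (s = 1 ∨ s = -1) ∧ d = s * f := by
      rcases sq_eq_sq_iff_eq_or_eq_neg.mp hd2 with h | h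
      · exact ⟨1, by simp, by rw [h, one_mul]⟩
      · exact ⟨-1, by simp, by rw [h, neg_one_mul]⟩
    -- Twice the indicator of χ(c) = s is χ(c)² + s χ(c); summing over c kills the linear term, and
    -- the sign s with it.
    have h1 : ∀ c : ZMod p, (2 * (if f * quadraticChar (ZMod p) c = s * f then 1 else 0) : ℤ) =
        quadraticChar (ZMod p) c ^ 2 + s * quadraticChar (ZMod p) c := by
      intro c
      simp only [mul_comm f, mul_left_inj' hf0]
      by_cases h : c = 0
      · rcases hs with rfl | rfl <;> simp [h]
      · rcases quadraticChar_dichotomy h with h | h <;> rcases hs with rfl | rfl <;> simp [h]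
    rw [card_eq_sum_ones, sum_filter, Nat.cast_sum, mul_sum]
    push_cast
    rw [sum_congr rfl fun c _ => h1 c, sum_add_distrib, ← mul_sum, quadraticChar_sum_zero hchar,
      ← add_sum_erase _ _ (mem_univ (0 : ZMod p)), sum_congr rfl fun c hc =>
        quadraticChar_sq_one (ne_of_mem_erase hc), sum_const, card_erase_of_mem (mem_univ _),
      card_univ, ZMod.card, nsmul_eq_mul, Nat.cast_pred hp1.pos, MulChar.map_zero]
    ring
  · rw [filter_false_of_mem]
    · simp
    · intro c _ h
      by_cases h2 : c = 0
      · rw [h2, MulChar.map_zero, mul_zero] at h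
        exact hd h.symm
      · apply hd2
        rw [← h, mul_pow, quadraticChar_sq_one h2, mul_one]

/-- For even `m`, the deviation is constant off `0`. -/
lemma exists_traceSqDev_eq_of_even (hp : p ≠ 2) (hF : Fintype.card F = p ^ m) (hm : Even m)
    (hm1 : 1 ≤ m) {a : F} (ha : a ≠ 0) :
    ∃ s : ℤ, (s = 1 ∨ s = -1) ∧
      traceSqDev m a (0 : ZMod p) = s * ((p - 1) * (p : ℤ) ^ ((m - 2) / 2)) ∧
      ∀ c : ZMod p, c ≠ 0 → traceSqDev m a c = -(s * (p : ℤ) ^ ((m - 2) / 2)) := by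
  obtain ⟨e, f, hef, h0, hc⟩ := exists_traceSqDev_eq hp hF hm1 ha
  obtain ⟨k, rfl⟩ := hm
  obtain ⟨j, rfl⟩ := Nat.exists_eq_add_of_le' (show 1 ≤ k by lia)
  obtain ⟨hf, he⟩ := (prime_mul_sq_add_sq_eq_pow Fact.out _ e f hef).2 ⟨j, by lia⟩
  have e1 : (j + 1 + (j + 1) - 2) / 2 = j := by lia
  have e2 : (j + 1 + (j + 1) - 1 - 1) = j * 2 := by lia
  rw [e2, pow_mul] at he
  rw [e1]
  -- The sign s is opposite to that of e.
  rcases sq_eq_sq_iff_eq_or_eq_neg.mp he with he | he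
  · exact ⟨-1, by simp, by rw [h0, he]; ring, fun c h => by rw [hc c h, he, hf]; ring⟩
  · exact ⟨1, by simp, by rw [h0, he]; ring, fun c h => by rw [hc c h, he, hf]; ring⟩

end deviation

/-! ### The trace-zero hyperplane -/

section hyperplane

open Finset

variable {p : ℕ} [Fact p.Prime] {F : Type*} [Field F] [Algebra (ZMod p) F] [Fintype F] {m : ℕ}

/-- If `a` has trace zero, then off the hyperplane `Tr b = 0` the form `Tr(b² / 4a)` takes all
values equally often. -/
lemma card_trace_ne_zero_and_trace_sq_div (hp : p ≠ 2) (hF : Fintype.card F = p ^ m) (hm : 1 ≤ m)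
    {a : F} (ha : a ≠ 0) (hta : Algebra.trace (ZMod p) F a = 0) (c : ZMod p) :
    #{b : F | Algebra.trace (ZMod p) F b ≠ 0 ∧ Algebra.trace (ZMod p) F (b ^ 2 / (4 * a)) = c} * p
      = p ^ m - p ^ (m - 1) := by
  have h2 := two_ne_zero_of_algebra_zmod (F := F) hp
  have h4 : (4 : F) ≠ 0 := by
    rw [show (4 : F) = 2 ^ 2 by norm_num]
    exact pow_ne_zero 2 h2
  have hmul : ∀ t : ZMod p, Algebra.trace (ZMod p) F (algebraMap (ZMod p) F t * (2 * a)) = 0 :=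
    fun t => by rw [trace_algebraMap_mul, two_mul, map_add, hta, add_zero, mul_zero]
  have hsq : ∀ (b : F) (t : ZMod p), Algebra.trace (ZMod p) F
      ((b + algebraMap (ZMod p) F t * (2 * a)) ^ 2 / (4 * a)) =
      Algebra.trace (ZMod p) F (b ^ 2 / (4 * a)) + t * Algebra.trace (ZMod p) F b := by
    intro b t
    have h : (b + algebraMap (ZMod p) F t * (2 * a)) ^ 2 / (4 * a) =
        b ^ 2 / (4 * a) + algebraMap (ZMod p) F t * b + algebraMap (ZMod p) F (t ^ 2) * a := by
      rw [map_pow]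
      field_simp
      ring
    rw [h, map_add, map_add, trace_algebraMap_mul, trace_algebraMap_mul, hta, mul_zero, add_zero]
  have hle : ∀ c c' : ZMod p,
      #{b : F | Algebra.trace (ZMod p) F b ≠ 0 ∧ Algebra.trace (ZMod p) F (b ^ 2 / (4 * a)) = c} ≤
      #{b : F | Algebra.trace (ZMod p) F b ≠ 0 ∧
        Algebra.trace (ZMod p) F (b ^ 2 / (4 * a)) = c'} := by
    intro c c'
    -- The shift that carries c to c' depends on b only through Tr b, which it preserves; hence it
    -- is injective. Exchanging c and c' gives equality.
    refine card_le_card_of_injOn (fun b => b + algebraMap (ZMod p) F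
      ((c' - c) / Algebra.trace (ZMod p) F b) * (2 * a)) ?_ ?_
    · intro b hb
      simp only [coe_filter, mem_univ, true_and, Set.mem_ofPred_eq] at hb ⊢
      rw [map_add, hmul, add_zero, hsq, hb.2, div_mul_cancel₀ _ hb.1]
      exact ⟨hb.1, by ring⟩
    · intro b _ b' _ h
      have h' := congrArg (Algebra.trace (ZMod p) F) h
      simp only [map_add, hmul, add_zero] at h'
      simpa only [h', add_left_inj] using h
  have hsum := card_eq_sum_card_fiberwise
    (s := ({b : F | Algebra.trace (ZMod p) F b ≠ 0} : Finset F)) (t := (univ : Finset (ZMod p)))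
    (f := fun b => Algebra.trace (ZMod p) F (b ^ 2 / (4 * a))) (fun _ _ => by simp)
  simp only [filter_filter] at hsum
  rw [sum_congr rfl fun d _ => (hle d c).antisymm (hle c d), sum_const, card_univ, ZMod.card,
    smul_eq_mul] at hsum
  have h0 := card_trace_mul_eq (p := p) hF hm (one_ne_zero (α := F)) 0
  simp only [one_mul] at h0
  have hc := card_filter_add_card_filter_not (s := (univ : Finset F))
    (fun b => Algebra.trace (ZMod p) F b = 0)
  rw [h0, card_univ, hF] at hc
  rw [mul_comm, ← hsum, ← hc, Nat.add_sub_cancel_left]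

/-- If `a` has trace zero, the value distribution of `Tr(b² / 4a)` on the hyperplane `Tr b = 0`. -/
lemma card_trace_eq_zero_and_trace_sq_div (hp : p ≠ 2) (hF : Fintype.card F = p ^ m) (hm : 2 ≤ m)
    {a : F} (ha : a ≠ 0) (hta : Algebra.trace (ZMod p) F a = 0) (c : ZMod p) :
    (#{b : F | Algebra.trace (ZMod p) F b = 0 ∧
        Algebra.trace (ZMod p) F (b ^ 2 / (4 * a)) = c} : ℤ)
      = (p : ℤ) ^ (m - 2) + traceSqDev m a c := by
  have hp1 : p.Prime := Fact.out
  have h2 := two_ne_zero_of_algebra_zmod (F := F) hp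
  have h4 : (4 : F) ≠ 0 := by
    rw [show (4 : F) = 2 ^ 2 by norm_num]
    exact pow_ne_zero 2 h2
  have h := card_trace_ne_zero_and_trace_sq_div hp hF (by lia) ha hta c
  -- The substitution b = 2 a x turns b²/4a into a x².
  have hN : traceSqCount a c = #{b : F | Algebra.trace (ZMod p) F (b ^ 2 / (4 * a)) = c} := by
    refine card_nbij' (fun x => 2 * a * x) (fun b => b / (2 * a)) ?_ ?_ ?_ ?_
    · intro x hx
      simp only [coe_filter, mem_univ, true_and, Set.mem_ofPred_eq] at hx ⊢
      rw [← hx]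
      congr 1
      field_simp
      ring
    · intro x hx
      simp only [coe_filter, mem_univ, true_and, Set.mem_ofPred_eq] at hx ⊢
      rw [← hx]
      congr 1
      field_simp
      norm_num
    · intro x _
      field_simp
    · intro x _
      field_simp
  have hc := card_filter_add_card_filter_not
    (s := ({b : F | Algebra.trace (ZMod p) F (b ^ 2 / (4 * a)) = c} : Finset F))
    (fun b => Algebra.trace (ZMod p) F b = 0)
  simp only [filter_filter, ← hN] at hc
  simp only [and_comm (a := Algebra.trace (ZMod p) F (_ / _) = c)] at hc
  obtain ⟨k, rfl⟩ := Nat.exists_eq_add_of_le' hm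
  simp only [Nat.add_sub_cancel, show k + 2 - 1 = k + 1 by lia] at h ⊢
  have hle : p ^ (k + 1) ≤ p ^ (k + 2) := Nat.pow_le_pow_right hp1.pos (by lia)
  zify [hle] at h hc
  have hp0 : (p : ℤ) ≠ 0 := Nat.cast_ne_zero.mpr hp1.ne_zero
  apply mul_right_cancel₀ hp0
  simp only [traceSqDev, show k + 2 - 1 = k + 1 by lia, ← hc]
  linear_combination -h

/-- Two trace conditions: `Tr a = 0` and `Tr (a w) = 0`. -/
lemma card_trace_eq_zero_and_trace_mul_eq_zero (hF : Fintype.card F = p ^ m) (hm : 2 ≤ m)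
    (w : F) [Decidable (w ∈ Set.range (algebraMap (ZMod p) F))] :
    #{a : F | Algebra.trace (ZMod p) F a = 0 ∧ Algebra.trace (ZMod p) F (a * w) = 0} =
      if w ∈ Set.range (algebraMap (ZMod p) F) then p ^ (m - 1) else p ^ (m - 2) := by
  classical
  have hp1 : p.Prime := Fact.out
  have h0 := card_trace_mul_eq (p := p) hF (by lia) (one_ne_zero (α := F)) 0
  simp only [one_mul] at h0
  split_ifs with hw
  · obtain ⟨t, rfl⟩ := hw
    rw [← h0]
    congr 1
    ext a
    simp only [mem_filter, mem_univ, true_and, and_iff_left_iff_imp]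
    intro h
    rw [mul_comm, trace_algebraMap_mul, h, mul_zero]
  · let V := LinearMap.ker (Algebra.trace (ZMod p) F)
    let g : V →ₗ[ZMod p] ZMod p := (traceMul p w).domRestrict V
    have hg : g ≠ 0 := by
      intro hg
      apply hw
      -- If Tr(w ·) vanishes on ker Tr, it is a multiple t Tr, and nondegeneracy gives w = t in
      -- GF(p).
      have hle : LinearMap.ker (Algebra.trace (ZMod p) F) ≤ LinearMap.ker (traceMul p w) := by
        intro x hx
        exact LinearMap.congr_fun hg ⟨x, hx⟩
      have hmem : traceMul p w ∈ Submodule.span (ZMod p) (Set.range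
          fun _ : Unit => Algebra.trace (ZMod p) F) :=
        mem_span_of_iInf_ker_le_ker (by simpa using hle)
      rw [Set.range_const, Submodule.mem_span_singleton] at hmem
      obtain ⟨t, ht⟩ := hmem
      refine ⟨t, ?_⟩
      rw [← sub_eq_zero]
      refine eq_zero_of_forall_trace_mul (p := p) fun x => ?_
      have := LinearMap.congr_fun ht x
      rw [sub_mul, map_sub, trace_algebraMap_mul, sub_eq_zero]
      simpa using this
    have h1 := card_fiber_mul_of_ne_zero hg 0
    have hV : Fintype.card V = p ^ (m - 1) := by
      rw [← h0, Fintype.card_subtype]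
      congr 1
      ext a
      simp [V]
    rw [hV, ZMod.card] at h1
    have h2 : #{x : V | g x = 0} =
        #{a : F | Algebra.trace (ZMod p) F a = 0 ∧ Algebra.trace (ZMod p) F (a * w) = 0} := by
      rw [← card_map (Function.Embedding.subtype _)]
      congr 1
      ext a
      simp [g, V, mul_comm w, and_comm]
    obtain ⟨k, rfl⟩ := Nat.exists_eq_add_of_le' hm
    rw [h2, show k + 2 - 1 = k + 1 by lia, pow_succ] at h1
    exact Nat.eq_of_mul_eq_mul_right hp1.pos h1

/-- For even `m`, all elements of the prime field are squares in `GF(p ^ m)`. -/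
lemma isSquare_algebraMap_of_even (hp : p ≠ 2) (hF : Fintype.card F = p ^ m) (hm : Even m)
    (t : ZMod p) : IsSquare (algebraMap (ZMod p) F t) := by
  have hp1 : p.Prime := Fact.out
  by_cases ht : t = 0
  · simp [ht]
  have hchar : ringChar F ≠ 2 := by
    have : CharP F p := (Algebra.charP_iff (ZMod p) F p).mp inferInstance
    rwa [ringChar.eq F p]
  rw [FiniteField.isSquare_iff hchar (by simpa using ht), hF, ← map_pow]
  obtain ⟨k, rfl⟩ := hm
  obtain ⟨i, hi⟩ : p - 1 ∣ p ^ k - 1 := by simpa using Nat.sub_dvd_pow_sub_pow p 1 k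
  obtain ⟨j, hj⟩ : Odd (p ^ k) := (hp1.odd_of_ne_two hp).pow
  -- Euler's exponent (q-1)/2 is a multiple of p-1: in q - 1 = (p^k - 1)(p^k + 1), p-1 divides the
  -- first factor and the second is even.
  have h : p ^ (k + k) / 2 = (p - 1) * (i * (j + 1)) := by
    have h3 : p ^ (k + k) = 2 * ((p - 1) * (i * (j + 1))) + 1 := by
      rw [← mul_assoc (p - 1), ← hi, pow_add, hj]
      simp only [Nat.add_sub_cancel]
      ring
    lia
  rw [h, pow_mul, ZMod.pow_card_sub_one_eq_one ht, one_pow, map_one]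

/-- Zero has one square root, and each of the p-1 nonzero elements of GF(p) has two. -/
lemma card_sq_mem_range_algebraMap (hp : p ≠ 2) (hF : Fintype.card F = p ^ m) (hm : Even m)
    [DecidablePred (· ∈ Set.range (algebraMap (ZMod p) F))] :
    #{x : F | x ^ 2 ∈ Set.range (algebraMap (ZMod p) F)} + 1 = 2 * p := by
  classical
  have hp1 : p.Prime := Fact.out
  have hchar : ringChar F ≠ 2 := by
    have : CharP F p := (Algebra.charP_iff (ZMod p) F p).mp inferInstance
    rwa [ringChar.eq F p]
  have hinj : Function.Injective (algebraMap (ZMod p) F) := (algebraMap (ZMod p) F).injective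
  rw [card_eq_sum_card_fiberwise (t := univ.image (algebraMap (ZMod p) F)) (f := fun x => x ^ 2)
    (fun x hx => by simpa using hx), sum_image hinj.injOn, ← add_sum_erase _ _ (mem_univ 0)]
  have h0 : ∀ t : ZMod p, #{x ∈ ({x : F | x ^ 2 ∈ Set.range (algebraMap (ZMod p) F)} : Finset F) |
      x ^ 2 = algebraMap (ZMod p) F t} = if t = 0 then 1 else 2 := by
    intro t
    have h := quadraticChar_card_sqrts hchar (algebraMap (ZMod p) F t)
    have h1 : ({x ∈ ({x : F | x ^ 2 ∈ Set.range (algebraMap (ZMod p) F)} : Finset F) |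
      x ^ 2 = algebraMap (ZMod p) F t} : Finset F) =
        {x : F | x ^ 2 = algebraMap (ZMod p) F t}.toFinset := by
      ext x
      simp only [mem_filter, mem_univ, true_and, Set.mem_toFinset, Set.mem_ofPred_eq,
        and_iff_right_iff_imp]
      intro hx
      exact ⟨t, hx.symm⟩
    rw [h1]
    zify
    rw [h]
    split_ifs with ht
    · simp [ht]
    · rw [(quadraticChar_one_iff_isSquare (by simpa using ht)).mpr
        (isSquare_algebraMap_of_even hp hF hm t)]
      norm_num
  rw [h0, sum_congr rfl fun t ht => by rw [h0, if_neg (ne_of_mem_erase ht)], sum_const,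
    card_erase_of_mem (mem_univ _), card_univ, ZMod.card, if_pos rfl, smul_eq_mul]
  have := hp1.two_le
  lia

/-- Pairs (a, x) with Tr a = Tr(a x²) = 0 are counted by x instead: there are p^(m-1) such a for the
2p-1 elements x with x² in GF(p), and p^(m-2) otherwise. The term a = 0 is then removed. -/
lemma sum_traceSqDev_zero_of_even [DecidableEq F] (hp : p ≠ 2) (hF : Fintype.card F = p ^ m)
    (hm : Even m) (hm1 : 1 ≤ m) :
    ∑ a ∈ ({a : F | Algebra.trace (ZMod p) F a = 0} : Finset F).erase 0,
      traceSqDev m a (0 : ZMod p) = ((p : ℤ) - 1) ^ 2 * (p : ℤ) ^ (m - 2) := by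
  classical
  have hp1 : p.Prime := Fact.out
  have hm2 : 2 ≤ m := by
    obtain ⟨k, rfl⟩ := hm
    lia
  have h0 := card_trace_mul_eq (p := p) hF (by lia) (one_ne_zero (α := F)) 0
  simp only [one_mul] at h0
  have hcount : ∑ a ∈ ({a : F | Algebra.trace (ZMod p) F a = 0} : Finset F),
      traceSqCount a (0 : ZMod p) =
      ∑ x : F, if x ^ 2 ∈ Set.range (algebraMap (ZMod p) F) then p ^ (m - 1) else p ^ (m - 2) := by
    simp only [traceSqCount, card_filter]
    rw [sum_comm]
    refine sum_congr rfl fun x _ => ?_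
    rw [← card_trace_eq_zero_and_trace_mul_eq_zero hF hm2, card_filter, sum_filter]
    refine sum_congr rfl fun a _ => ?_
    rw [ite_and]
  have hcard := card_sq_mem_range_algebraMap hp hF hm
  have hcompl := card_filter_add_card_filter_not (s := (univ : Finset F))
    (fun x => x ^ 2 ∈ Set.range (algebraMap (ZMod p) F))
  rw [sum_ite, sum_const, sum_const] at hcount
  have hz : (0 : F) ∈ ({a : F | Algebra.trace (ZMod p) F a = 0} : Finset F) := by simp
  rw [← add_sum_erase _ _ hz] at hcount
  have hN0 : traceSqCount (0 : F) (0 : ZMod p) = p ^ m := by simp [traceSqCount, hF]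
  have hce := card_erase_add_one hz
  rw [h0] at hce
  rw [hN0] at hcount
  rw [card_univ, hF] at hcompl
  simp only [traceSqDev, sum_sub_distrib, sum_const, nsmul_eq_mul]
  obtain ⟨k, rfl⟩ := Nat.exists_eq_add_of_le' hm2
  simp only [show k + 2 - 1 = k + 1 by lia, Nat.add_sub_cancel, smul_eq_mul] at *
  zify at *
  have e1 : (#{x : F | x ^ 2 ∈ Set.range (algebraMap (ZMod p) F)} : ℤ) = 2 * p - 1 := by
    linear_combination hcard
  have e2 : (#{x : F | ¬ x ^ 2 ∈ Set.range (algebraMap (ZMod p) F)} : ℤ) =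
      p ^ (k + 2) - (2 * p - 1) := by
    linear_combination hcompl - e1
  rw [e1, e2] at hcount
  linear_combination hcount - (p : ℤ) ^ (k + 1) * hce

end hyperplane

/-! ### Shortening preserves dimension and weights -/

section shortening

variable {ι K : Type*} [Field K]

lemma injOn_funLeft_subcodeVanishingOn (C : Submodule K (ι → K)) (T : Set ι) :
    Set.InjOn (LinearMap.funLeft K K (Subtype.val : {i : ι // i ∉ T} → ι))
      (subcodeVanishingOn C T) := by
  intro u hu v hv h
  funext i
  by_cases hi : i ∈ T
  · rw [hu.2 i hi, hv.2 i hi]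
  · exact congrFun h ⟨i, hi⟩

lemma finrank_shortenedCode (C : Submodule K (ι → K)) (T : Set ι) :
    Module.finrank K (shortenedCode C T) = Module.finrank K (subcodeVanishingOn C T) := by
  rw [shortenedCode, puncturedCode, ← LinearMap.range_domRestrict]
  apply LinearMap.finrank_range_of_inj
  intro u v h
  exact Subtype.ext (injOn_funLeft_subcodeVanishingOn C T u.2 v.2 h)

lemma hammingNorm_eq_natCard [Fintype ι] [DecidableEq K] (v : ι → K) :
    hammingNorm v = Nat.card {i // v i ≠ 0} := by
  rw [hammingNorm, Nat.card_eq_fintype_card, Fintype.card_subtype]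

/-- `Nat.card` frees the weight from the instances chosen inside `numCodewords`. -/
lemma numCodewords_eq [Finite ι] (C : Submodule K (ι → K)) (w : ℕ) :
    numCodewords C w = Set.ncard {v : ι → K | v ∈ C ∧ Nat.card {i // v i ≠ 0} = w} := by
  classical
  unfold numCodewords
  simp only [hammingNorm_eq_natCard]

lemma numCodewords_shortenedCode [Finite ι] (C : Submodule K (ι → K)) (T : Set ι) (w : ℕ) :
    numCodewords (shortenedCode C T) w = numCodewords (subcodeVanishingOn C T) w := by
  have hw : ∀ v ∈ subcodeVanishingOn C T, Nat.card {i : {i : ι // i ∉ T} //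
      LinearMap.funLeft K K (Subtype.val : {i : ι // i ∉ T} → ι) v i ≠ 0} =
      Nat.card {i // v i ≠ 0} := by
    intro v hv
    refine Nat.card_congr ⟨fun i => ⟨i.1.1, i.2⟩, fun i => ⟨⟨i.1, fun h => i.2 (hv.2 _ h)⟩, i.2⟩,
      fun _ => rfl, fun _ => rfl⟩
  rw [numCodewords_eq, numCodewords_eq]
  rw [← ((injOn_funLeft_subcodeVanishingOn C T).mono fun v hv => hv.1).ncard_image]
  congr 1
  ext u
  constructor
  · rintro ⟨⟨v, hv, rfl⟩, hu⟩
    exact ⟨v, ⟨hv, by rw [← hu, hw v hv]⟩, rfl⟩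
  · rintro ⟨v, ⟨hv, hu⟩, rfl⟩
    exact ⟨⟨v, hv, rfl⟩, by rw [← hu, hw v hv]⟩

end shortening

/-! ### The shortened code as pairs (a, b) of trace zero -/

section quadraticTraceCode

open Finset

variable {p : ℕ} [Fact p.Prime] {F : Type*} [Field F] [Algebra (ZMod p) F]

/-- The linear map sending `(a, b)` to the word `(Tr(a x² + b x))_x`. -/
noncomputable def quadraticTraceWord (p : ℕ) [Fact p.Prime] (F : Type*) [Field F]
    [Algebra (ZMod p) F] : (F × F) →ₗ[ZMod p] (F → ZMod p) where
  toFun z x := Algebra.trace (ZMod p) F (z.1 * x ^ 2 + z.2 * x)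
  map_add' z w := by
    funext x
    rw [Pi.add_apply, ← map_add]
    congr 1
    simp only [Prod.fst_add, Prod.snd_add]
    ring
  map_smul' r z := by
    funext x
    rw [Pi.smul_apply, ← map_smul]
    simp only [Prod.smul_fst, Prod.smul_snd, smul_add, smul_mul_assoc, RingHom.id_apply]

lemma quadraticTraceWord_apply (z : F × F) (x : F) :
    quadraticTraceWord p F z x = Algebra.trace (ZMod p) F (z.1 * x ^ 2 + z.2 * x) := rfl

lemma quadraticTraceWord_injective [Finite F] (hp : p ≠ 2) :
    Function.Injective (quadraticTraceWord p F) := by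
  have h2 : (2 : ZMod p) ≠ 0 := two_ne_zero_of_algebra_zmod hp
  rw [injective_iff_map_eq_zero]
  rintro ⟨a, b⟩ h
  have hx : ∀ x : F, Algebra.trace (ZMod p) F (a * x ^ 2) + Algebra.trace (ZMod p) F (b * x) = 0 :=
    fun x => by
      have := congrFun h x
      rwa [quadraticTraceWord_apply, map_add] at this
  have hb : ∀ x : F, Algebra.trace (ZMod p) F (b * x) = 0 := fun x => by
    have h1 := hx x
    have h3 := hx (-x)
    rw [neg_sq, mul_neg, map_neg] at h3
    have : 2 * Algebra.trace (ZMod p) F (b * x) = 0 := by linear_combination h1 - h3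
    simpa [h2] using this
  have ha : ∀ x : F, Algebra.trace (ZMod p) F (a * x ^ 2) = 0 := fun x => by
    simpa [hb x] using hx x
  -- Polarisation: a(x+1)² - a x² - a = 2 a x.
  have ha' : ∀ x : F, Algebra.trace (ZMod p) F (a * x) = 0 := fun x => by
    have h1 := ha (x + 1)
    rw [show a * (x + 1) ^ 2 = a * x ^ 2 + (a * x + a * x) + a * 1 ^ 2 by ring, map_add, map_add,
      map_add, ha, ha] at h1
    have : 2 * Algebra.trace (ZMod p) F (a * x) = 0 := by linear_combination h1
    simpa [h2] using this
  rw [eq_zero_of_forall_trace_mul ha', eq_zero_of_forall_trace_mul hb]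
  rfl

lemma subcodeVanishingOn_traceCode_eq (hp : p ≠ 2) :
    subcodeVanishingOn (traceCode p F (X ^ 2)) (Set.range (algebraMap (ZMod p) F)) =
      ((LinearMap.ker (Algebra.trace (ZMod p) F)).prod
        (LinearMap.ker (Algebra.trace (ZMod p) F))).map (quadraticTraceWord p F) := by
  have h2 : (2 : ZMod p) ≠ 0 := two_ne_zero_of_algebra_zmod hp
  ext v
  constructor
  · rintro ⟨⟨a, b, c, rfl⟩, hv⟩
    have h : ∀ t : ZMod p, t ^ 2 * Algebra.trace (ZMod p) F a + t * Algebra.trace (ZMod p) F b +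
        Algebra.trace (ZMod p) F c = 0 := by
      intro t
      have := hv _ ⟨t, rfl⟩
      beta_reduce at this
      rw [eval_pow, eval_X, ← map_pow, mul_comm a, mul_comm b, map_add, map_add,
        trace_algebraMap_mul, trace_algebraMap_mul] at this
      exact this
    have hc : Algebra.trace (ZMod p) F c = 0 := by simpa using h 0
    have ha : Algebra.trace (ZMod p) F a = 0 := by
      have : 2 * Algebra.trace (ZMod p) F a = 0 := by
        linear_combination h 1 + h (-1) - 2 * hc
      simpa [h2] using this
    have hb : Algebra.trace (ZMod p) F b = 0 := by
      have : 2 * Algebra.trace (ZMod p) F b = 0 := by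
        linear_combination h 1 - h (-1)
      simpa [h2] using this
    refine ⟨(a, b), ⟨ha, hb⟩, ?_⟩
    funext x
    rw [quadraticTraceWord_apply, eval_pow, eval_X, map_add _ _ c, hc, add_zero]
  · rintro ⟨⟨a, b⟩, ⟨ha, hb⟩, rfl⟩
    refine ⟨⟨a, b, 0, by funext x; simp [quadraticTraceWord_apply]⟩, ?_⟩
    rintro _ ⟨t, rfl⟩
    replace ha : Algebra.trace (ZMod p) F a = 0 := ha
    replace hb : Algebra.trace (ZMod p) F b = 0 := hb
    rw [quadraticTraceWord_apply, ← map_pow, mul_comm a, mul_comm b, map_add,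
      trace_algebraMap_mul, trace_algebraMap_mul, ha, hb, mul_zero, mul_zero, add_zero]

variable [Fintype F] {m : ℕ}

lemma card_ker_trace (hF : Fintype.card F = p ^ m) (hm : 1 ≤ m) :
    #{x : F | Algebra.trace (ZMod p) F x = 0} = p ^ (m - 1) := by
  simpa only [one_mul] using card_trace_mul_eq (p := p) hF hm (one_ne_zero (α := F)) 0

lemma finrank_ker_trace (hF : Fintype.card F = p ^ m) (hm : 1 ≤ m) :
    Module.finrank (ZMod p) (LinearMap.ker (Algebra.trace (ZMod p) F)) = m - 1 := by
  classical
  have h := Module.card_eq_pow_finrank (K := ZMod p)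
    (V := LinearMap.ker (Algebra.trace (ZMod p) F))
  rw [ZMod.card, Fintype.card_subtype] at h
  apply Nat.pow_right_injective (Fact.out : p.Prime).two_le
  simp only
  rw [← h, ← card_ker_trace hF hm]
  congr 1
  ext x
  simp

lemma isLinearCode_shortenedCode_traceCode (hp : p ≠ 2) (hF : Fintype.card F = p ^ m)
    (hm : 1 ≤ m) :
    IsLinearCode (shortenedCode (traceCode p F (X ^ 2)) (Set.range (algebraMap (ZMod p) F)))
      (p ^ m - p) (2 * m - 2) := by
  classical
  constructor
  · rw [Nat.card_eq_fintype_card, Fintype.card_subtype_compl, hF,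
      Set.card_range_of_injective (algebraMap (ZMod p) F).injective, ZMod.card]
  · have hprod : ∀ V : Submodule (ZMod p) F,
        V.prod V = LinearMap.range (V.subtype.prodMap V.subtype) := fun V => by
      rw [LinearMap.range_prodMap, Submodule.range_subtype]
    rw [finrank_shortenedCode, subcodeVanishingOn_traceCode_eq hp,
      ← (Submodule.equivMapOfInjective _ (quadraticTraceWord_injective hp) _).finrank_eq,
      hprod,
      LinearMap.finrank_range_of_inj
        (Function.Injective.prodMap Subtype.val_injective Subtype.val_injective),
      Module.finrank_prod, finrank_ker_trace hF hm]
    lia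

/-- The number of zeros of the word `(Tr(a x² + b x))_x`, where `a ≠ 0`. -/
lemma card_trace_quadratic_eq_zero (hp : p ≠ 2) {a : F} (ha : a ≠ 0) (b : F) :
    #{x : F | Algebra.trace (ZMod p) F (a * x ^ 2 + b * x) = 0} =
      traceSqCount a (Algebra.trace (ZMod p) F (b ^ 2 / (4 * a))) := by
  have h2 := two_ne_zero_of_algebra_zmod (F := F) hp
  have h4 : (4 : F) ≠ 0 := by
    rw [show (4 : F) = 2 ^ 2 by norm_num]
    exact pow_ne_zero 2 h2
  have key : ∀ x : F, Algebra.trace (ZMod p) F (a * x ^ 2 + b * x) =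
      Algebra.trace (ZMod p) F (a * (x + b / (2 * a)) ^ 2) -
        Algebra.trace (ZMod p) F (b ^ 2 / (4 * a)) := by
    intro x
    rw [← map_sub]
    congr 1
    field_simp
    ring
  refine card_nbij' (fun x => x + b / (2 * a)) (fun x => x - b / (2 * a)) ?_ ?_ ?_ ?_
  · intro x hx
    simp only [coe_filter, mem_univ, true_and, Set.mem_ofPred_eq, key, sub_eq_zero] at hx ⊢
    exact hx
  · intro x hx
    simp only [coe_filter, mem_univ, true_and, Set.mem_ofPred_eq, key, sub_eq_zero] at hx ⊢
    rw [sub_add_cancel]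
    exact hx
  · intro x _
    simp
  · intro x _
    simp

lemma numCodewords_shortenedCode_traceCode (hp : p ≠ 2) (hF : Fintype.card F = p ^ m) (w : ℕ) :
    numCodewords (shortenedCode (traceCode p F (X ^ 2)) (Set.range (algebraMap (ZMod p) F))) w =
      ∑ a : F with Algebra.trace (ZMod p) F a = 0,
        #{b : F | Algebra.trace (ZMod p) F b = 0 ∧
          #{x : F | Algebra.trace (ZMod p) F (a * x ^ 2 + b * x) = 0} + w = p ^ m} := by
  classical
  rw [numCodewords_shortenedCode, numCodewords_eq, subcodeVanishingOn_traceCode_eq hp]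
  have h1 : {v : F → ZMod p | v ∈ ((LinearMap.ker (Algebra.trace (ZMod p) F)).prod
        (LinearMap.ker (Algebra.trace (ZMod p) F))).map (quadraticTraceWord p F) ∧
        Nat.card {i // v i ≠ 0} = w} = quadraticTraceWord p F ''
      (↑({z : F × F | Algebra.trace (ZMod p) F z.1 = 0 ∧ Algebra.trace (ZMod p) F z.2 = 0 ∧
        #{x : F | Algebra.trace (ZMod p) F (z.1 * x ^ 2 + z.2 * x) = 0} + w = p ^ m} :
          Finset (F × F)) : Set (F × F)) := by
    have hwt : ∀ z : F × F, #{x : F | Algebra.trace (ZMod p) F (z.1 * x ^ 2 + z.2 * x) = 0} +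
        Nat.card {i // quadraticTraceWord p F z i ≠ 0} = p ^ m := by
      intro z
      rw [Nat.card_eq_fintype_card, Fintype.card_subtype, ← hF, ← card_univ]
      exact card_filter_add_card_filter_not _
    ext v
    constructor
    · rintro ⟨⟨z, ⟨h1, h2⟩, rfl⟩, h⟩
      refine ⟨z, ?_, rfl⟩
      simp only [coe_filter, mem_univ, true_and, Set.mem_ofPred_eq]
      exact ⟨h1, h2, by rw [← h, hwt]⟩
    · rintro ⟨z, hz, rfl⟩
      simp only [coe_filter, mem_univ, true_and, Set.mem_ofPred_eq] at hz
      exact ⟨⟨z, ⟨hz.1, hz.2.1⟩, rfl⟩, Nat.add_left_cancel ((hwt z).trans hz.2.2.symm)⟩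
  rw [h1, Set.ncard_image_of_injective _ (quadraticTraceWord_injective hp), Set.ncard_coe_finset,
    card_eq_sum_card_fiberwise (t := ({a : F | Algebra.trace (ZMod p) F a = 0} : Finset F))
      (f := Prod.fst) (fun z hz => by
        simp only [coe_filter, mem_univ, true_and, Set.mem_ofPred_eq] at hz ⊢
        exact hz.1)]
  refine sum_congr rfl fun a ha => ?_
  simp only [mem_filter, mem_univ, true_and] at ha
  refine card_nbij' (fun z => z.2) (fun b => (a, b)) ?_ ?_ ?_ ?_
  · rintro ⟨z, b⟩ hz
    simp only [coe_filter, mem_filter, mem_univ, true_and, Set.mem_ofPred_eq] at hz ⊢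
    obtain ⟨⟨_, h⟩, rfl⟩ := hz
    exact h
  · intro b hb
    simp only [coe_filter, mem_filter, mem_univ, true_and, Set.mem_ofPred_eq] at hb ⊢
    exact ⟨⟨ha, hb⟩, trivial⟩
  · rintro ⟨z, b⟩ hz
    simp only [coe_filter, mem_filter, mem_univ, true_and, Set.mem_ofPred_eq] at hz ⊢
    rw [hz.2]
  · intro b _
    rfl

/-- The weight enumerator in terms of the deviations. -/
lemma numCodewords_eq_sum_card_traceSqDev [DecidableEq F] (hp : p ≠ 2)
    (hF : Fintype.card F = p ^ m) (hm : 1 ≤ m) {w : ℕ} {d : ℤ}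
    (hw : (w : ℤ) = (p : ℤ) ^ (m - 1) * (p - 1) - d) :
    (numCodewords (shortenedCode (traceCode p F (X ^ 2))
        (Set.range (algebraMap (ZMod p) F))) w : ℤ) =
      (if w = 0 then 1 else 0) + (if d = 0 then (p : ℤ) ^ (m - 1) - 1 else 0) +
      ((p : ℤ) ^ (m - 2) + d) *
        ∑ a ∈ ({a : F | Algebra.trace (ZMod p) F a = 0} : Finset F).erase 0,
          (#{c : ZMod p | traceSqDev m a c = d} : ℤ) := by
  have hp1 : p.Prime := Fact.out
  have hpm : (p : ℤ) ^ m = p ^ (m - 1) * p := by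
    rw [← pow_succ, Nat.sub_add_cancel hm]
  have hz : (0 : F) ∈ ({a : F | Algebra.trace (ZMod p) F a = 0} : Finset F) := by simp
  have hcard := card_ker_trace hF hm
  rw [numCodewords_shortenedCode_traceCode hp hF, ← add_sum_erase _ _ hz]
  push_cast
  rw [mul_sum]
  congr 1
  -- The case a = 0: b = 0 is the zero word, and every other b gives p^(m-1) zeros, that is d = 0.
  · rw [← filter_filter, card_filter, ← add_sum_erase _ _ hz]
    push_cast
    congr 1
    · simp [hF]
    · have h1 : ∀ b ∈ ({a : F | Algebra.trace (ZMod p) F a = 0} : Finset F).erase 0,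
          (if #{x : F | Algebra.trace (ZMod p) F (0 * x ^ 2 + b * x) = 0} + w = p ^ m
            then 1 else 0 : ℤ) = if d = 0 then 1 else 0 := by
        intro b hb
        simp only [zero_mul, zero_add]
        rw [card_trace_mul_eq hF hm (ne_of_mem_erase hb)]
        congr 1
        zify
        rw [hw, hpm]
        apply propext
        constructor <;> intro h <;> linarith
      rw [sum_congr rfl h1, sum_const, card_erase_of_mem hz, hcard, nsmul_eq_mul,
        Nat.cast_pred (pow_pos hp1.pos _)]
      push_cast
      split_ifs <;> ring
  · refine sum_congr rfl fun a ha => ?_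
    have ha0 := ne_of_mem_erase ha
    have hta : Algebra.trace (ZMod p) F a = 0 := by simpa using mem_of_mem_erase ha
    -- For m = 1 the kernel of the trace is trivial, so the truncated exponent m - 2 meets only an
    -- empty sum.
    have hm2 : 2 ≤ m := by
      by_contra hlt
      obtain rfl : m = 1 := by lia
      have hlt : 1 < #{a : F | Algebra.trace (ZMod p) F a = 0} :=
        one_lt_card.mpr ⟨a, mem_of_mem_erase ha, 0, hz, ha0⟩
      simp [hcard] at hlt
    simp only [card_trace_quadratic_eq_zero hp ha0]
    rw [card_eq_sum_card_fiberwise (t := (univ : Finset (ZMod p)))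
      (f := fun b => Algebra.trace (ZMod p) F (b ^ 2 / (4 * a))) (fun _ _ => by simp),
      card_filter]
    push_cast
    rw [mul_sum]
    refine sum_congr rfl fun c _ => ?_
    rw [filter_filter]
    have hiff : traceSqCount a c + w = p ^ m ↔ traceSqDev m a c = d := by
      zify
      rw [hw, hpm, traceSqDev]
      constructor <;> intro h <;> linarith
    split_ifs with hd
    · rw [← hd, mul_one, ← card_trace_eq_zero_and_trace_sq_div hp hF hm2 ha0 hta]
      congr 2
      ext b
      simp only [mem_filter, mem_univ, true_and]
      constructor
      · rintro ⟨⟨h1, _⟩, h3⟩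
        exact ⟨h1, h3⟩
      · rintro ⟨h1, h3⟩
        exact ⟨⟨h1, by rw [h3, hiff, hd]⟩, h3⟩
    · rw [mul_zero, Nat.cast_eq_zero, card_eq_zero]
      apply filter_false_of_mem
      rintro b _ ⟨⟨h1, h2⟩, h3⟩
      rw [h3, hiff] at h2
      exact hd h2

end quadraticTraceCode

/-! ### The weight tables -/

section weightDistribution

open Finset

variable {p : ℕ} [Fact p.Prime] {F : Type*} [Field F] [Algebra (ZMod p) F] [Fintype F] {m : ℕ}

lemma two_mul_numCodewords_of_odd (hp : p ≠ 2) (hF : Fintype.card F = p ^ m) (hm : Odd m)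
    {w : ℕ} {d : ℤ} (hw : (w : ℤ) = (p : ℤ) ^ (m - 1) * (p - 1) - d) :
    (2 * numCodewords (shortenedCode (traceCode p F (X ^ 2))
        (Set.range (algebraMap (ZMod p) F))) w : ℤ) =
      (if w = 0 then 2 else 0) + (if d = 0 then 2 * ((p : ℤ) ^ (m - 1) - 1) else 0) +
      ((p : ℤ) ^ (m - 2) + d) * (((p : ℤ) ^ (m - 1) - 1) *
        if d = 0 then 2 else if d ^ 2 = (p : ℤ) ^ (m - 1) then (p : ℤ) - 1 else 0) := by
  classical
  rw [numCodewords_eq_sum_card_traceSqDev hp hF hm.pos hw, mul_add, mul_add, mul_left_comm (2 : ℤ),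
    mul_sum, sum_congr rfl fun a ha =>
      card_traceSqDev_eq_of_odd hp hF hm (ne_of_mem_erase ha) d, sum_const,
    card_erase_of_mem (by simp), card_ker_trace hF hm.pos, nsmul_eq_mul,
    Nat.cast_pred (pow_pos (Fact.out : p.Prime).pos _)]
  push_cast
  congr 2 <;> split_ifs <;> ring

/-- `2 * (number of codewords)` for even `m`; the sign `s` can be chosen freely. -/
lemma two_mul_numCodewords_of_even (hp : p ≠ 2) (hF : Fintype.card F = p ^ m) (hm : Even m)
    (hm1 : 1 ≤ m) {s : ℤ} (hs : s = 1 ∨ s = -1) {w : ℕ} {d : ℤ}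
    (hw : (w : ℤ) = (p : ℤ) ^ (m - 1) * (p - 1) - d) :
    (2 * numCodewords (shortenedCode (traceCode p F (X ^ 2))
        (Set.range (algebraMap (ZMod p) F))) w : ℤ) =
      (if w = 0 then 2 else 0) + (if d = 0 then 2 * ((p : ℤ) ^ (m - 1) - 1) else 0) +
      ((p : ℤ) ^ (m - 2) + d) *
        (((p : ℤ) ^ (m - 1) - 1 + s * ((p - 1) * (p : ℤ) ^ ((m - 2) / 2))) *
          (if d = s * ((p - 1) * (p : ℤ) ^ ((m - 2) / 2)) then 1 else
            if d = -(s * (p : ℤ) ^ ((m - 2) / 2)) then (p : ℤ) - 1 else 0) +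
        ((p : ℤ) ^ (m - 1) - 1 - s * ((p - 1) * (p : ℤ) ^ ((m - 2) / 2))) *
          (if d = -s * ((p - 1) * (p : ℤ) ^ ((m - 2) / 2)) then 1 else
            if d = -(-s * (p : ℤ) ^ ((m - 2) / 2)) then (p : ℤ) - 1 else 0)) := by
  classical
  have hp1 : p.Prime := Fact.out
  have hp0 : (0 : ℤ) < (p : ℤ) - 1 := by
    have : (2 : ℤ) ≤ p := by exact_mod_cast hp1.two_le
    lia
  set r : ℤ := (p : ℤ) ^ ((m - 2) / 2) with hr
  have hr0 : 0 < r := pow_pos (by exact_mod_cast hp1.pos) _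
  have hrr : r ^ 2 = (p : ℤ) ^ (m - 2) := by
    rw [hr, ← pow_mul, Nat.div_mul_cancel]
    exact (Nat.even_sub' (by obtain ⟨k, rfl⟩ := hm; lia)).mpr (by
      constructor <;> intro h
      · exact absurd hm (Nat.not_even_iff_odd.mpr h)
      · exact absurd h (by decide)) |>.two_dvd
  have hz : (0 : F) ∈ ({a : F | Algebra.trace (ZMod p) F a = 0} : Finset F) := by simp
  have hex : ∀ a : F, a ≠ 0 → ∃ ε : ℤ, (ε = 1 ∨ ε = -1) ∧
      traceSqDev m a (0 : ZMod p) = ε * ((p - 1) * r) ∧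
      ∀ c : ZMod p, c ≠ 0 → traceSqDev m a c = -(ε * r) :=
    fun a ha => exists_traceSqDev_eq_of_even hp hF hm hm1 ha
  choose! ε hε hε0 hεc using hex
  have hsum := sum_traceSqDev_zero_of_even (F := F) hp hF hm hm1
  rw [sum_congr rfl fun a ha => hε0 a (ne_of_mem_erase ha), ← sum_mul] at hsum
  have hsumε : ∑ a ∈ ({a : F | Algebra.trace (ZMod p) F a = 0} : Finset F).erase 0, ε a =
      (p - 1) * r := by
    apply mul_right_cancel₀ (mul_pos hp0 hr0).ne'
    rw [hsum, ← hrr]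
    ring
  -- `g t` is the number of c with deviation d when the sign of a is t.
  set g : ℤ → ℤ := fun t => if d = t * ((p - 1) * r) then 1 else if d = -(t * r) then (p : ℤ) - 1
    else 0 with hg
  -- Interpolation on {1, -1} makes the count affine in the sign `ε a`, so only the sum of the signs
  -- is needed.
  have hcnt : ∀ a : F, a ≠ 0 → (2 * #{c : ZMod p | traceSqDev m a c = d} : ℤ) =
      (g s + g (-s)) + ε a * (s * (g s - g (-s))) := by
    intro a ha
    have h1 : (#{c : ZMod p | traceSqDev m a c = d} : ℤ) = g (ε a) := by
      rw [card_filter, ← add_sum_erase _ _ (mem_univ (0 : ZMod p)), hε0 a ha,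
        sum_congr rfl fun c hc => by rw [hεc a ha c (ne_of_mem_erase hc)], sum_const,
        card_erase_of_mem (mem_univ _), card_univ, ZMod.card, smul_eq_mul]
      push_cast [Nat.cast_pred hp1.pos]
      have hne : ε a * ((p - 1) * r) ≠ -(ε a * r) := by
        intro h
        have h2 : ε a * (p * r) = 0 := by linear_combination h
        have h3 : (p : ℤ) * r ≠ 0 := mul_ne_zero (by lia) hr0.ne'
        rcases hε a ha with h | h <;> simp [h, h3] at h2
      simp only [hg]
      by_cases e1 : d = ε a * ((p - 1) * r)
      · rw [if_pos e1.symm, if_pos e1, if_neg fun h => hne (e1.symm.trans h.symm)]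
        ring
      · rw [if_neg fun h => e1 h.symm, if_neg e1]
        by_cases e2 : d = -(ε a * r)
        · rw [if_pos e2.symm, if_pos e2]
          ring
        · rw [if_neg fun h => e2 h.symm, if_neg e2]
          ring
    rw [h1]
    rcases hε a ha with h | h <;> rcases hs with rfl | rfl <;> rw [h] <;> simp <;> ring
  have hmain : 2 * ∑ a ∈ ({a : F | Algebra.trace (ZMod p) F a = 0} : Finset F).erase 0,
      (#{c : ZMod p | traceSqDev m a c = d} : ℤ) =
      ((p : ℤ) ^ (m - 1) - 1 + s * ((p - 1) * r)) * g s +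
        ((p : ℤ) ^ (m - 1) - 1 - s * ((p - 1) * r)) * g (-s) := by
    rw [mul_sum, sum_congr rfl fun a ha => hcnt a (ne_of_mem_erase ha), sum_add_distrib, ← sum_mul,
      hsumε, sum_const, card_erase_of_mem hz, card_ker_trace hF hm1, nsmul_eq_mul,
      Nat.cast_pred (pow_pos hp1.pos _)]
    push_cast
    ring
  rw [numCodewords_eq_sum_card_traceSqDev hp hF hm1 hw, mul_add, mul_add, mul_left_comm (2 : ℤ),
    hmain]
  congr 2 <;> split_ifs <;> ring

lemma neg_one_pow_cast_complex {s : ℤ} {i j : ℕ} (hs : s = (-1) ^ i) (h : Even (i + j)) :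
    ((-1 : ℂ)) ^ j = s := by
  rw [hs]
  push_cast
  rcases Nat.even_or_odd i with hi | hi
  · rw [hi.neg_one_pow, ((Nat.even_add.mp h).mp hi).neg_one_pow]
  · have hj : Odd j := by
      rw [← Nat.not_even_iff_odd] at hi ⊢
      exact fun hj => hi ((Nat.even_add.mp h).mpr hj)
    rw [hi.neg_one_pow, hj.neg_one_pow]

lemma exists_odd_pow_two_mul (n k : ℕ) : ∃ i, (2 * n + 1) ^ (2 * k) = 4 * i + 1 := by
  induction k with
  | zero => exact ⟨0, by simp⟩
  | succ k ih =>
    obtain ⟨i, hi⟩ := ih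
    refine ⟨i * (2 * n + 1) ^ 2 + n ^ 2 + n, ?_⟩
    rw [mul_add, pow_add, hi]
    ring

theorem hasWeightTable_of_odd (hp : p ≠ 2) (hF : Fintype.card F = p ^ m) (hm : Odd m) :
    HasWeightTable
      (shortenedCode (traceCode p F (X ^ 2)) (Set.range (algebraMap (ZMod p) F)))
      (oddTable p m) := by
  have hp1 : p.Prime := Fact.out
  have hp3 : 3 ≤ p := by
    have := hp1.two_le
    lia
  have hcount := fun w d => two_mul_numCodewords_of_odd (w := w) (d := d) hp hF hm
  set C := shortenedCode (traceCode p F (X ^ 2)) (Set.range (algebraMap (ZMod p) F)) with hC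
  set s : ℤ := (-1) ^ ((p - 1) * (m + 1) / 4) with hs
  have hs1 : s = 1 ∨ s = -1 := neg_one_pow_eq_or ℤ _
  set r : ℕ := p ^ ((m - 1) / 2) with hr
  -- With p = 2n+1 and m = 2k+1, (q-1)/2 has the parity of n, and the other two exponents are nk and
  -- nk + n.
  have hB : constB p m = s * r := by
    rw [constB, neg_one_pow_cast_complex hs, hr]
    · push_cast
      rfl
    · obtain ⟨k, rfl⟩ := hm
      obtain ⟨n, rfl⟩ := hp1.odd_of_ne_two hp
      obtain ⟨i, hi⟩ := exists_odd_pow_two_mul n k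
      have e1 : ((2 * n + 1) ^ (2 * k + 1) - 1) / 2 = 2 * (i * (2 * n + 1)) + n := by
        rw [pow_succ, hi, show (4 * i + 1) * (2 * n + 1) =
          2 * (2 * (i * (2 * n + 1)) + n) + 1 by ring]
        lia
      have e2 : (2 * n + 1 - 1) * (2 * k + 1 + 1) / 4 = n * k + n := by
        rw [show (2 * n + 1 - 1) * (2 * k + 1 + 1) = 4 * (n * k + n) by
          rw [Nat.add_sub_cancel]; ring]
        lia
      have e3 : (2 * n + 1 - 1) * (2 * k + 1 - 1) / 4 = n * k := by
        rw [show (2 * n + 1 - 1) * (2 * k + 1 - 1) = 4 * (n * k) by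
          rw [Nat.add_sub_cancel, Nat.add_sub_cancel]; ring]
        lia
      rw [e1, e2, e3]
      exact ⟨n * k + n + i * (2 * n + 1), by ring⟩
  have hrP : p ^ (m - 1) = r ^ 2 := by
    rw [hr, ← pow_mul, Nat.div_mul_cancel (Nat.Odd.sub_odd hm odd_one).two_dvd]
  have hr1 : 1 ≤ r := Nat.one_le_pow _ _ hp1.pos
  -- For m = 1 the powers p^(-1) and p^0 differ, but the factor p^(m-1) - 1 is zero.
  have hz : ((p : ℂ) ^ (m - 1) - 1) * (p : ℂ) ^ ((m : ℤ) - 2) =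
      ((p : ℂ) ^ (m - 1) - 1) * (p : ℂ) ^ (m - 2) := by
    by_cases h1 : m = 1
    · simp [h1]
    · have : 2 ≤ m := by
        have := hm.pos
        lia
      rw [← zpow_natCast (p : ℂ) (m - 2), Nat.cast_sub this]
      rfl
  have hPz : (p : ℤ) ^ (m - 1) = r ^ 2 := by exact_mod_cast hrP
  have hPc : (p : ℂ) ^ (m - 1) = r ^ 2 := by exact_mod_cast hrP
  have hrz : (p : ℤ) ^ ((m - 1) / 2) = r := by
    rw [hr]
    push_cast
    rfl
  have hW : (2 * r : ℤ) ≤ (r : ℤ) ^ 2 * ((p : ℤ) - 1) := by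
    have : (1 : ℤ) ≤ r := by exact_mod_cast hr1
    have : (3 : ℤ) ≤ p := by exact_mod_cast hp3
    nlinarith
  have hrpos : (1 : ℤ) ≤ r := by exact_mod_cast hr1
  rw [hPc] at hz
  simp only [oddTable, hB, ← hs, hPz, hPc, hrz]
  rw [hPz] at hcount
  refine ⟨?_, ?_, ?_⟩
  · simp only [List.map_cons, List.map_nil, List.nodup_cons, List.mem_cons, List.not_mem_nil,
      or_false, not_or, not_false_eq_true, List.nodup_nil, and_true]
    generalize (r : ℤ) ^ 2 * ((p : ℤ) - 1) = W at *
    rcases hs1 with h | h <;> rw [h] <;> lia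
  · have hrow : ∀ (W d : ℤ) (M : ℂ), W = (r : ℤ) ^ 2 * (p - 1) - d → 0 ≤ W →
        (2 * M = (((if W = 0 then 2 else 0) + (if d = 0 then 2 * ((r : ℤ) ^ 2 - 1) else 0) +
          ((p : ℤ) ^ (m - 2) + d) * (((r : ℤ) ^ 2 - 1) *
          if d = 0 then 2 else if d ^ 2 = (r : ℤ) ^ 2 then (p : ℤ) - 1 else 0) : ℤ) : ℂ)) →
        ∃ w : ℕ, (w : ℤ) = W ∧ (numCodewords C w : ℂ) = M := by
      intro W d M hW0 hW1 hM
      obtain ⟨w, rfl⟩ := Int.eq_ofNat_of_zero_le hW1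
      refine ⟨w, rfl, ?_⟩
      have h := hcount w d hW0
      simp only [Nat.cast_eq_zero] at hM
      rw [← h] at hM
      push_cast at hM
      exact (mul_left_cancel₀ two_ne_zero hM).symm
    have hW0 : (r : ℤ) ^ 2 * ((p : ℤ) - 1) ≠ 0 := by linarith
    have hsgn : ∀ t : ℤ, t = 1 ∨ t = -1 → r * t ≠ 0 ∧ (r * t) ^ 2 = (r : ℤ) ^ 2 ∧
        0 < (r : ℤ) ^ 2 * ((p : ℤ) - 1) - r * t := by
      rintro t (rfl | rfl)
      · exact ⟨by linarith, by ring, by linarith⟩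
      · exact ⟨by linarith, by ring, by linarith⟩
    obtain ⟨hs2, hs3, hs4⟩ := hsgn s hs1
    obtain ⟨hs5, hs6, hs7⟩ := hsgn (-s) (by rcases hs1 with h | h <;> simp [h])
    simp only [List.mem_cons, List.not_mem_nil, or_false]
    rintro _ (rfl | rfl | rfl | rfl)
    · refine hrow _ ((r : ℤ) ^ 2 * (p - 1)) _ (by ring) le_rfl ?_
      rw [if_pos rfl, if_neg hW0, if_neg hW0, if_neg fun h => by nlinarith]
      push_cast
      ring
    · refine hrow _ 0 _ (by ring) (by linarith) ?_
      rw [if_neg hW0, if_pos rfl, if_pos rfl]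
      push_cast
      linear_combination 2 * hz
    · refine hrow _ (r * s) _ (by ring) hs4.le ?_
      rw [if_neg hs4.ne', if_neg hs2, if_neg hs2, if_pos hs3]
      push_cast
      linear_combination ((p : ℂ) - 1) * hz
    · refine hrow _ (r * -s) _ (by ring) (by linarith) ?_
      rw [if_neg (by linarith), if_neg hs5, if_neg hs5, if_pos hs6]
      push_cast
      linear_combination ((p : ℂ) - 1) * hz
  · intro w hw
    have h := hcount w ((r : ℤ) ^ 2 * (p - 1) - w) (by ring)
    simp only [List.map_cons, List.map_nil, List.mem_cons, List.not_mem_nil, or_false]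
    by_contra! hne
    obtain ⟨h0, h1, h2, h3⟩ := hne
    have hd : (r : ℤ) ^ 2 * (p - 1) - w ≠ 0 := fun h => h1 (by linarith)
    have hd2 : ((r : ℤ) ^ 2 * (p - 1) - w) ^ 2 ≠ (r : ℤ) ^ 2 := by
      intro h
      rcases sq_eq_sq_iff_eq_or_eq_neg.mp h with h | h <;> rcases hs1 with e | e <;>
        rw [e] at h2 h3 <;> lia
    rw [if_neg (by exact_mod_cast h0), if_neg hd, if_neg hd, if_neg hd2] at h
    apply hw
    have : (numCodewords C w : ℤ) = 0 := by linarith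
    exact_mod_cast this
/-- The weight table of a code whose weight enumerator has the shape found for even `m`. -/
lemma hasWeightTable_of_two_mul_numCodewords {ι K : Type*} [Finite ι] [Field K]
    (C : Submodule K (ι → K)) {W N Q k u v : ℤ} (hu : u ≠ 0) (hv : v ≠ 0) (huv : u ≠ v)
    (huv' : u ≠ -v) (hW0 : 0 < W) (hWu : u < W) (hWu' : -u < W) (hWv : v < W) (hWv' : -v < W)
    (hk : k * v = u) (hN : N = (k + 1) * Q)
    (hcount : ∀ (w : ℕ) (d : ℤ), (w : ℤ) = W - d → (2 * numCodewords C w : ℤ) =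
      (if w = 0 then 2 else 0) + (if d = 0 then 2 * (N - 1) else 0) +
      (Q + d) * ((N - 1 + u) * (if d = u then 1 else if d = -v then k else 0) +
        (N - 1 - u) * (if d = -u then 1 else if d = v then k else 0))) :
    HasWeightTable C
      [(0, 1), (W, (N : ℂ) - 1),
        (W + u, ((N : ℂ) - 1 - u) / 2 * (Q - u)),
        (W - u, ((N : ℂ) - 1 - ((N : ℂ) - 1 - u) / 2) * (Q + u)),
        (W - v, ((N : ℂ) - 1 - u) / 2 * (N - Q + u)),
        (W + v, ((N : ℂ) - 1 - ((N : ℂ) - 1 - u) / 2) * (N - Q - u))] := by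
  have hkc : (k : ℂ) * v = u := by exact_mod_cast hk
  have hNc : (N : ℂ) = (k + 1) * Q := by exact_mod_cast hN
  refine ⟨?_, ?_, ?_⟩
  · simp only [List.map_cons, List.map_nil, List.nodup_cons, List.mem_cons, List.not_mem_nil,
      or_false, not_or, not_false_eq_true, List.nodup_nil, and_true]
    refine ⟨⟨?_, ?_, ?_, ?_, ?_⟩, ⟨?_, ?_, ?_, ?_⟩, ⟨?_, ?_, ?_⟩, ⟨?_, ?_⟩, ?_⟩ <;> omega
  · have hrow : ∀ (w' d : ℤ) (M : ℂ), w' = W - d → 0 ≤ w' →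
        (2 * M = (((if w' = 0 then 2 else 0) + (if d = 0 then 2 * (N - 1) else 0) +
          (Q + d) * ((N - 1 + u) * (if d = u then 1 else if d = -v then k else 0) +
          (N - 1 - u) * (if d = -u then 1 else if d = v then k else 0)) : ℤ) : ℂ)) →
        ∃ w : ℕ, (w : ℤ) = w' ∧ (numCodewords C w : ℂ) = M := by
      intro w' d M hd hw' hM
      obtain ⟨w, rfl⟩ := Int.eq_ofNat_of_zero_le hw'
      refine ⟨w, rfl, ?_⟩
      have h := hcount w d hd
      simp only [Nat.cast_eq_zero] at hM
      rw [← h] at hM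
      push_cast at hM
      exact (mul_left_cancel₀ two_ne_zero hM).symm
    simp only [List.mem_cons, List.not_mem_nil, or_false]
    rintro _ (rfl | rfl | rfl | rfl | rfl | rfl)
    · refine hrow _ W _ (by omega) le_rfl ?_
      rw [if_pos rfl, if_neg (by omega), if_neg (by omega), if_neg (by omega), if_neg (by omega),
        if_neg (by omega)]
      push_cast
      ring
    · refine hrow _ 0 _ (by omega) (by omega) ?_
      rw [if_neg (by omega), if_pos rfl, if_neg (by omega), if_neg (by omega), if_neg (by omega),
        if_neg (by omega)]
      push_cast
      ring
    · refine hrow _ (-u) _ (by omega) (by omega) ?_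
      rw [if_neg (by omega), if_neg (by omega), if_neg (by omega), if_neg (by omega), if_pos rfl]
      push_cast
      ring
    · refine hrow _ u _ (by omega) (by omega) ?_
      rw [if_neg (by omega), if_neg (by omega), if_pos rfl, if_neg (by omega), if_neg (by omega)]
      push_cast
      ring
    · refine hrow _ v _ (by omega) (by omega) ?_
      rw [if_neg (by omega), if_neg (by omega), if_neg (by omega), if_neg (by omega),
        if_neg (by omega), if_pos rfl]
      push_cast
      -- Here k (Q + v) = N - Q + u; the last row uses the same identity with u and v negated.
      linear_combination ((N : ℂ) - 1 - u) * (hNc - hkc)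
    · refine hrow _ (-v) _ (by omega) (by omega) ?_
      rw [if_neg (by omega), if_neg (by omega), if_neg (by omega), if_pos rfl, if_neg (by omega),
        if_neg (by omega)]
      push_cast
      linear_combination ((N : ℂ) - 1 + u) * (hNc + hkc)
  · intro w hw
    have h := hcount w (W - w) (by ring)
    simp only [List.map_cons, List.map_nil, List.mem_cons, List.not_mem_nil, or_false]
    by_contra! hne
    obtain ⟨h0, h1, h2, h3, h4, h5⟩ := hne
    rw [if_neg (by omega), if_neg (by omega), if_neg (by omega), if_neg (by omega),
      if_neg (by omega), if_neg (by omega)] at h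
    apply hw
    have : (numCodewords C w : ℤ) = 0 := by linarith
    exact_mod_cast this

theorem hasWeightTable_of_even (hp : p ≠ 2) (hF : Fintype.card F = p ^ m) (hm : Even m)
    (hm1 : 1 ≤ m) :
    HasWeightTable
      (shortenedCode (traceCode p F (X ^ 2)) (Set.range (algebraMap (ZMod p) F)))
      (evenTable p m) := by
  have hp1 : p.Prime := Fact.out
  have hp3 : 3 ≤ p := by
    have := hp1.two_le
    lia
  have hm2 : 2 ≤ m := by
    obtain ⟨k, rfl⟩ := hm
    lia
  set s : ℤ := (-1) ^ (m * (p - 1) / 4) with hs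
  have hs1 : s = 1 ∨ s = -1 := neg_one_pow_eq_or ℤ _
  have hcount := fun w d => two_mul_numCodewords_of_even (w := w) (d := d) hp hF hm hm1 hs1
  set C := shortenedCode (traceCode p F (X ^ 2)) (Set.range (algebraMap (ZMod p) F)) with hC
  set r : ℕ := p ^ ((m - 2) / 2) with hr
  have hsneg : (-1 : ℤ) ^ ((m * (p - 1) + 4) / 4) = -s := by
    rw [Nat.add_div_right _ (by norm_num), pow_succ, ← hs, mul_neg_one]
  have hrc : (p : ℂ) ^ ((m - 2) / 2) = r := by
    rw [hr]
    push_cast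
    rfl
  have hB₁ : constB₁ p m = ((p : ℂ) ^ (m - 1) - 1 - s * ((p - 1) * r)) / 2 := by
    have h : Complex.I ^ ((p - 1) * m / 2) = s := by
      obtain ⟨k, rfl⟩ := hm
      obtain ⟨n, rfl⟩ := hp1.odd_of_ne_two hp
      rw [show (2 * n + 1 - 1) * (k + k) / 2 = 2 * (n * k) by
        rw [Nat.add_sub_cancel, show 2 * n * (k + k) = 2 * (2 * (n * k)) by ring]; lia, pow_mul,
        Complex.I_sq]
      apply neg_one_pow_cast_complex hs
      rw [show (k + k) * (2 * n + 1 - 1) / 4 = n * k by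
        rw [Nat.add_sub_cancel, show (k + k) * (2 * n) = 4 * (n * k) by ring]; lia]
      exact ⟨n * k, rfl⟩
    rw [constB₁, h, hrc]
    ring
  -- Since m is even, q ≡ 1 mod 4, so (q+1)/2 is odd and flips the sign s.
  have hB₂ : constB₂ p m = -s * ((p - 1) * r) := by
    have h : (-1 : ℂ) ^ ((p ^ m + 1) / 2 + m * (p - 1) / 4) = ((-s : ℤ) : ℂ) := by
      apply neg_one_pow_cast_complex hsneg.symm
      obtain ⟨k, rfl⟩ := hm
      obtain ⟨n, rfl⟩ := hp1.odd_of_ne_two hp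
      obtain ⟨i, hi⟩ := exists_odd_pow_two_mul n k
      rw [← two_mul k, hi, Nat.add_div_right _ (by norm_num), show (4 * i + 1 + 1) / 2 = 2 * i + 1 by lia]
      exact ⟨2 * k * (2 * n + 1 - 1) / 4 + i + 1, by ring⟩
    rw [constB₂, h, hrc]
    push_cast
    ring
  have hP : p ^ (m - 2) = r ^ 2 := by
    rw [hr, ← pow_mul, Nat.div_mul_cancel]
    obtain ⟨k, rfl⟩ := hm
    exact ⟨k - 1, by lia⟩
  have hP' : p ^ (m - 1) = p * r ^ 2 := by
    rw [← hP, ← pow_succ']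
    congr 1
    lia
  have hPz : (p : ℤ) ^ (m - 1) = p * r ^ 2 := by exact_mod_cast hP'
  have hPc : (p : ℂ) ^ (m - 1) = p * r ^ 2 := by exact_mod_cast hP'
  have hQz : (p : ℤ) ^ (m - 2) = r ^ 2 := by exact_mod_cast hP
  have hQc : (p : ℂ) ^ (m - 2) = r ^ 2 := by exact_mod_cast hP
  have hrz : (p : ℤ) ^ ((m - 2) / 2) = r := by
    rw [hr]
    push_cast
    rfl
  have hrpos : (1 : ℤ) ≤ r := by exact_mod_cast Nat.one_le_pow _ _ hp1.pos
  have hpz : (3 : ℤ) ≤ p := by exact_mod_cast hp3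
  have htable : evenTable p m = [(0, 1), ((p : ℤ) * r ^ 2 * ((p : ℤ) - 1),
      (((p : ℤ) * r ^ 2 : ℤ) : ℂ) - 1),
      ((p : ℤ) * r ^ 2 * ((p : ℤ) - 1) + s * (((p : ℤ) - 1) * r),
        ((((p : ℤ) * r ^ 2 : ℤ) : ℂ) - 1 - ((s * (((p : ℤ) - 1) * r) : ℤ) : ℂ)) / 2 *
          ((((r : ℤ) ^ 2 : ℤ) : ℂ) - ((s * (((p : ℤ) - 1) * r) : ℤ) : ℂ))),
      ((p : ℤ) * r ^ 2 * ((p : ℤ) - 1) - s * (((p : ℤ) - 1) * r),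
        ((((p : ℤ) * r ^ 2 : ℤ) : ℂ) - 1 - ((((p : ℤ) * r ^ 2 : ℤ) : ℂ) - 1 -
          ((s * (((p : ℤ) - 1) * r) : ℤ) : ℂ)) / 2) *
          ((((r : ℤ) ^ 2 : ℤ) : ℂ) + ((s * (((p : ℤ) - 1) * r) : ℤ) : ℂ))),
      ((p : ℤ) * r ^ 2 * ((p : ℤ) - 1) - s * r,
        ((((p : ℤ) * r ^ 2 : ℤ) : ℂ) - 1 - ((s * (((p : ℤ) - 1) * r) : ℤ) : ℂ)) / 2 *
          ((((p : ℤ) * r ^ 2 : ℤ) : ℂ) - (((r : ℤ) ^ 2 : ℤ) : ℂ) +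
            ((s * (((p : ℤ) - 1) * r) : ℤ) : ℂ))),
      ((p : ℤ) * r ^ 2 * ((p : ℤ) - 1) + s * r,
        ((((p : ℤ) * r ^ 2 : ℤ) : ℂ) - 1 - ((((p : ℤ) * r ^ 2 : ℤ) : ℂ) - 1 -
          ((s * (((p : ℤ) - 1) * r) : ℤ) : ℂ)) / 2) *
          ((((p : ℤ) * r ^ 2 : ℤ) : ℂ) - (((r : ℤ) ^ 2 : ℤ) : ℂ) -
            ((s * (((p : ℤ) - 1) * r) : ℤ) : ℂ)))] := by
    simp only [evenTable, hB₁, hB₂, ← hs, hsneg, hPz, hPc, hrz, hQc]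
    push_cast
    simp only [List.cons.injEq, Prod.mk.injEq, and_true, true_and]
    refine ⟨⟨?_, ?_⟩, ⟨?_, ?_⟩, ⟨?_, ?_⟩, ?_, ?_⟩ <;> ring
  -- These two bounds keep the weights distinct and the nonzero ones positive.
  have hrR : 2 * (r : ℤ) ≤ ((p : ℤ) - 1) * r := by nlinarith
  have hRW : ((p : ℤ) - 1) * r < p * (r : ℤ) ^ 2 * ((p : ℤ) - 1) := by
    have h3 : 3 ≤ (p : ℤ) * r := by nlinarith
    nlinarith
  rw [htable]
  simp only [hPz, hQz, hrz] at hcount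
  clear_value s
  -- Here u = s (p-1) r, v = s r, N = p r² and Q = r².
  refine hasWeightTable_of_two_mul_numCodewords C (k := (p : ℤ) - 1) ?_ ?_ ?_ ?_ ?_ ?_ ?_ ?_ ?_
    (by ring) (by ring) fun w d hw => ?_
  on_goal 10 =>
    rw [hcount w d hw]
    simp only [neg_mul, neg_neg]
  all_goals
    generalize ((p : ℤ) - 1) * r = R at *
    generalize (p : ℤ) * r ^ 2 * ((p : ℤ) - 1) = W at *
    clear hcount htable hB₁ hB₂
    rcases hs1 with rfl | rfl <;> omega

end weightDistribution

theorem mainTheorem4 (p : ℕ) [Fact p.Prime] (hp : p ≠ 2) (m : ℕ) (hm : 1 ≤ m)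
    (F : Type*) [Field F] [Finite F] [Algebra (ZMod p) F] (hF : Nat.card F = p ^ m) :
    IsLinearCode (shortenedCode (traceCode p F (X ^ 2)) (Set.range (algebraMap (ZMod p) F)))
      (p ^ m - p) (2 * m - 2) ∧
    (Odd m → HasWeightTable
      (shortenedCode (traceCode p F (X ^ 2)) (Set.range (algebraMap (ZMod p) F)))
      (oddTable p m)) ∧
    (Even m → HasWeightTable
      (shortenedCode (traceCode p F (X ^ 2)) (Set.range (algebraMap (ZMod p) F)))
      (evenTable p m)) := by
  have := Fintype.ofFinite F
  rw [Nat.card_eq_fintype_card] at hF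
  exact ⟨isLinearCode_shortenedCode_traceCode hp hF hm, fun h => hasWeightTable_of_odd hp hF h,
    fun h => hasWeightTable_of_even hp hF h hm⟩
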